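/- \textbf{Setting.} Let $K\ge 2$, let $\{f(\cdot;\theta)\}_{\theta\in\Theta}$ be a family of probability distributions on $\mathbb{R}$, and let $z_k(\vartheta,\mathcal{R}_{t-1})\in\mathbb{R}$ be an oracle quantity: the value of arm $k\in[K]$ in round $t$, depending (measurably in the history) on the parameters $\vartheta=(\vartheta_i)_{i\in[K]}\in\Theta^K$ of all arms and on the history $\mathcal{R}_{t-1}$ of pulled arms and rewards before round $t$. A policy $\pi$ chooses the arm $k(t)=\pi(\mathcal{R}_{t-1},X_t)$, where $X_t$ is a fresh sequence of independent uniform random variables; then a reward is drawn from the distribution of the arm $k(t)$. Under the parameters $\theta=(\theta_k)_{k\in[K]}$ arm $k$ always has the distribution $f_k=f(\cdot;\theta_k)$; write $\mathbb{P}$ for the law of the play, $z_{k,t}=z_k(\theta,\mathcal{R}_{t-1})$, $k^*(t)=\operatorname{argmax}_k z_{k,t}$, and $N(t)=\#\{\tau\le t: k(\tau)\text{ does not maximize } z_{\cdot,\tau}\}$ for the number of failures. \textbf{Condition (a).} $\mathbb{P}$-almost surely the maximizer of $k\mapsto z_{k,t}$ is unique in every round $t$. \textbf{Modified problems and condition (c).}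 Let $\theta'=(\theta'_{k,j})_{k,j\in[K]}\in\Theta^{K\times K}$. In the modified problem given by $\theta'$, arm $k$ has in round $\tau$ the parameter $\theta'_{k,k^*(\tau)}$, where $k^*(\tau)$ is the optimal arm for the original parameters $\theta$ and the current history (the least maximizer in case of a tie). Its oracle quantity is $z'_{k,\tau}=z_k\big((\theta'_{i,k^*(\tau)})_{i\in[K]},\mathcal{R}_{\tau-1}\big)$, and its failures are the pulls of arms that do not maximize $z'_{\cdot,\tau}$. Call $\theta'$ admissible if (i) $\theta'_{j,j}=\theta_j$ for all $j$; (ii) $\mathbb{P}$-almost surely $z'_{k,\tau}>z_{k^*(\tau),\tau}$ and $z'_{k,\tau}>z'_{k^*(\tau),\tau}$ for all rounds $\tau$ and all $k\ne k^*(\tau)$ (the second inequality follows from the first and (i) if $z_k$ depends on $\vartheta$ only through $\vartheta_k$); (iii) $f_k\ll f(\cdot;\theta'_{k,j})$ and $\mathrm{KL}\big(f_k,f(\cdot;\theta'_{k,j})\big)<\infty$ for all $k,j$. Condition (c): an admissible $\theta'$ exists. \textbf{Consistency.} For $0<\delta<1$, the policy is $\delta$-consistent if its expected number of failures in the first $t$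 rounds is $o(t^\delta)$ in every problem with constant parameters that satisfies (a) and in every modified problem that an admissible $\theta'$ gives for it. It is consistent if it is $\delta$-consistent for all $0<\delta<1$. \textbf{Rates.} Let $N_{k,j}(t)=\#\{\tau\le t: k(\tau)=k,\ k^*(\tau)=j\}$, $$M(\theta')=\limsup_{t\to\infty}\frac1{N(t)}\sum_{k,j\in[K]}N_{k,j}(t)\,\mathrm{KL}\big(f_k,f(\cdot;\theta'_{k,j})\big),\qquad \tilde M=\inf\{M(\theta'):\theta'\text{ admissible}\}$$ (random quantities in $[0,\infty]$). \textbf{Proposition 2 (lower bound of failures).} Suppose that $\theta$ satisfies conditions (a) and (c). If the policy is consistent, then $\mathbb{P}$-almost surely $N(t)=\Omega(\ln t)$; more precisely, $\mathbb{P}$-almost surely, for every $c\ge 0$ with $c<1/\tilde M$ (where $1/0=\infty$), $N(t)>c\ln t$ for all sufficiently large $t$. If, for some $0<\delta<1$, the policy is only $\delta$-consistent, then the same holds with $(1-\delta)/\tilde M$ in place of $1/\tilde M$ (in particular still $N(t)=\Omega(\ln t)$ almost surely). -/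

import Mathlib

open MeasureTheory ProbabilityTheory Filter Asymptotics
open scoped ENNReal NNReal

noncomputable section

/-- The history `R_n` of the first `n` rounds: the pulled arm and the reward of each of them. -/
abbrev Hist (K n : ℕ) : Type := Fin n → Fin K × ℝ

/-- An infinite play of the game. The coordinate `n` is round `n + 1`. -/
abbrev Play (K : ℕ) : Type := ℕ → Fin K × ℝ

/-- The history of a play before its coordinate `n`. -/
def Play.hist {K : ℕ} (ω : Play K) (n : ℕ) : Hist K n := fun i => ω i

/-- The set of indices at which a vector attains its maximum. -/
def argmaxSet {K : ℕ} (v : Fin K → ℝ) : Finset (Fin K) :=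
  Finset.univ.filter fun k => ∀ j, v j ≤ v k

theorem argmaxSet_nonempty {K : ℕ} [NeZero K] (v : Fin K → ℝ) : (argmaxSet v).Nonempty := by
  obtain ⟨k, hk⟩ := Finite.exists_max v
  exact ⟨k, by simpa [argmaxSet] using hk⟩

/-- The argmax of a vector (the least index, if the maximum is attained more than once). -/
def argmax {K : ℕ} [NeZero K] (v : Fin K → ℝ) : Fin K := (argmaxSet v).min' (argmaxSet_nonempty v)

theorem argmax_eq_iff {K : ℕ} [NeZero K] (v : Fin K → ℝ) (k : Fin K) :
    argmax v = k ↔ (∀ j, v j ≤ v k) ∧ ∀ i, (∀ j, v j ≤ v i) → k ≤ i := by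
  unfold argmax
  rw [Finset.min'_eq_iff]
  simp [argmaxSet]

theorem measurable_argmax {K : ℕ} [NeZero K] : Measurable (argmax : (Fin K → ℝ) → Fin K) := by
  refine measurable_to_countable' fun k => ?_
  have h : argmax ⁻¹' {k} =
      {v : Fin K → ℝ | (∀ j, v j ≤ v k) ∧ ∀ i, (∀ j, v j ≤ v i) → k ≤ i} := by
    ext v
    simp [argmax_eq_iff]
  rw [h]
  measurability

/-- The seed `X_t` of one round: a sequence of uniform random variables on the unit interval. -/
abbrev Seed : Type := ℕ → unitInterval

/-- The law of a seed: independent uniform coordinates. -/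
def seedLaw : Measure Seed := Measure.infinitePi fun _ => (volume : Measure unitInterval)

instance : IsProbabilityMeasure seedLaw := by unfold seedLaw; infer_instance

/-- A policy chooses the arm of the next round from the history and a fresh seed. -/
structure Policy (K : ℕ) where
  choose : ∀ n : ℕ, Hist K n → Seed → Fin K
  measurable_choose : ∀ n, Measurable fun p : Hist K n × Seed => choose n p.1 p.2

/-- The conditional law of the next arm given the history. -/
def Policy.armKernel {K : ℕ} (π : Policy K) (n : ℕ) : Kernel (Hist K n) (Fin K) :=
  (Kernel.id ×ₖ Kernel.const (Hist K n) seedLaw).map fun p => π.choose n p.1 p.2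

instance {K : ℕ} (π : Policy K) (n : ℕ) : IsMarkovKernel (π.armKernel n) :=
  Kernel.IsMarkovKernel.map _ (π.measurable_choose n)

/-- The data that are common to all bandit problems of one kind: the family `f(·;θ)` of reward
distributions, and the oracle quantity `z n ϑ h k`, the value of arm `k` in round `n + 1`
if the arms have the parameters `ϑ` and the history before that round is `h`. -/
structure BanditModel (K : ℕ) (Θ : Type*) where
  f : Θ → Measure ℝ
  isProbabilityMeasure_f : ∀ a, IsProbabilityMeasure (f a)
  z : ∀ n : ℕ, (Fin K → Θ) → Hist K n → Fin K → ℝ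
  measurable_z : ∀ n ϑ, Measurable (z n ϑ)

namespace BanditModel

variable {K : ℕ} {Θ : Type*} (B : BanditModel K Θ)

/-- A bandit instance: the parameters of the arms in each round, which may depend on the history
before that round. -/
structure Instance where
  param : ∀ n : ℕ, Hist K n → Fin K → Θ
  measurable_f_param : ∀ n, Measurable fun p : Hist K n × Fin K => B.f (param n p.1 p.2)

/-- The ordinary instance, with constant parameters `θ`. -/
def stationary (θ : Fin K → Θ) : B.Instance where
  param _ _ := θ
  measurable_f_param _ :=
    (measurable_of_countable fun k : Fin K => B.f (θ k)).comp measurable_snd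

variable {B} in
/-- The law of the reward of the next round given the history and the pulled arm. -/
def Instance.rewardKernel (E : B.Instance) (n : ℕ) : Kernel (Hist K n × Fin K) ℝ where
  toFun p := B.f (E.param n p.1 p.2)
  measurable' := E.measurable_f_param n

instance (E : B.Instance) (n : ℕ) : IsMarkovKernel (E.rewardKernel n) :=
  ⟨fun p => B.isProbabilityMeasure_f (E.param n p.1 p.2)⟩

/-- One round: the policy chooses an arm, and the reward is drawn from the law of that arm. -/
def stepKernel (E : B.Instance) (π : Policy K) (n : ℕ) : Kernel (Hist K n) (Fin K × ℝ) :=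
  π.armKernel n ⊗ₖ E.rewardKernel n

instance (E : B.Instance) (π : Policy K) (n : ℕ) : IsMarkovKernel (B.stepKernel E π n) := by
  unfold stepKernel; infer_instance

/-- The restriction of a play to its coordinates `≤ n`, as a history of `n + 1` rounds. -/
def toHist (n : ℕ) (x : (i : Finset.Iic n) → Fin K × ℝ) : Hist K (n + 1) :=
  fun i => x ⟨i, Finset.mem_Iic.2 (Nat.le_of_lt_succ i.2)⟩

theorem measurable_toHist (n : ℕ) : Measurable (toHist (K := K) n) :=
  measurable_pi_lambda _ fun _ => measurable_pi_apply _

/-- The law of the whole play when the policy `π` plays the instance `E`. -/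
def law (E : B.Instance) (π : Policy K) : Measure (Play K) :=
  Kernel.trajMeasure (X := fun _ : ℕ => Fin K × ℝ) (B.stepKernel E π 0 Fin.elim0)
    fun n => (B.stepKernel E π (n + 1)).comap (toHist n) (measurable_toHist n)

instance (E : B.Instance) (π : Policy K) : IsProbabilityMeasure (B.law E π) := by
  unfold law; infer_instance

/-- In its coordinate `n` the play `ω` pulls an arm that is not optimal in the instance `E`. -/
def IsFailure (E : B.Instance) (ω : Play K) (n : ℕ) : Prop :=
  ∃ j, B.z n (E.param n (ω.hist n)) (ω.hist n) (ω n).1 < B.z n (E.param n (ω.hist n)) (ω.hist n) j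

open Classical in
/-- The number `N(t)` of failures in the first `t` rounds. -/
def failures (E : B.Instance) (ω : Play K) (t : ℕ) : ℕ :=
  ((Finset.range t).filter fun n => B.IsFailure E ω n).card

/-- Condition (a): almost surely the optimal arm is unique in every round. -/
def UniqueOptimum (π : Policy K) (θ : Fin K → Θ) : Prop :=
  ∀ᵐ ω ∂B.law (B.stationary θ) π, ∀ n, ∃! k, ∀ j, B.z n θ (ω.hist n) j ≤ B.z n θ (ω.hist n) k

variable [NeZero K]

/-- The optimal arm `k*` of the next round, under the parameters `θ`. -/
def opt (θ : Fin K → Θ) (n : ℕ) (h : Hist K n) : Fin K := argmax (B.z n θ h)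

theorem measurable_opt (θ : Fin K → Θ) (n : ℕ) : Measurable (B.opt θ n) :=
  measurable_argmax.comp (B.measurable_z n θ)

/-- The modified instance: arm `k` has the parameter `θ' k k*` while `k*` is the arm that is optimal
under the original parameters `θ`. -/
def modified (θ : Fin K → Θ) (θ' : Fin K → Fin K → Θ) : B.Instance where
  param n h k := θ' k (B.opt θ n h)
  measurable_f_param n :=
    (measurable_of_countable fun q : Fin K × Fin K => B.f (θ' q.2 q.1)).comp
      (((B.measurable_opt θ n).comp measurable_fst).prodMk measurable_snd)

/-- The modified parameter sets of condition (c). -/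
structure Admissible (π : Policy K) (θ : Fin K → Θ) (θ' : Fin K → Fin K → Θ) : Prop where
  /-- The optimal arm keeps its parameter. -/
  diag : ∀ j, θ' j j = θ j
  /-- Every other arm gets a value above the original optimum, and above the modified value of
  the originally optimal arm (the same number if `z` sees only the arm's own parameter). -/
  better : ∀ᵐ ω ∂B.law (B.stationary θ) π, ∀ n, ∀ k, k ≠ B.opt θ n (ω.hist n) →
    B.z n θ (ω.hist n) (B.opt θ n (ω.hist n)) <
        B.z n (fun i => θ' i (B.opt θ n (ω.hist n))) (ω.hist n) k ∧
      B.z n (fun i => θ' i (B.opt θ n (ω.hist n))) (ω.hist n) (B.opt θ n (ω.hist n)) <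
        B.z n (fun i => θ' i (B.opt θ n (ω.hist n))) (ω.hist n) k
  ac : ∀ k j, B.f (θ k) ≪ B.f (θ' k j)
  klDiv_ne_top : ∀ k j, InformationTheory.klDiv (B.f (θ k)) (B.f (θ' k j)) ≠ ∞

/-- The policy has `E[N(t)] = o(t^δ)` on the instance `E`, `N(t)` being the failures in `E`. -/
def ConsistentOn (δ : ℝ) (π : Policy K) (E : B.Instance) : Prop :=
  (fun t : ℕ => ∫ ω, (B.failures E ω t : ℝ) ∂B.law E π) =o[atTop] fun t : ℕ => (t : ℝ) ^ δ

/-- Consistency with the exponent `δ`: expected failures `o(t^δ)`, whatever the parameters of the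
problem are. The problems are those with constant parameters that satisfy condition (a), and their
modifications in the sense of condition (c). -/
def ConsistentWith (δ : ℝ) (π : Policy K) : Prop :=
  ∀ θ : Fin K → Θ, B.UniqueOptimum π θ →
    B.ConsistentOn δ π (B.stationary θ) ∧
      ∀ θ', B.Admissible π θ θ' → B.ConsistentOn δ π (B.modified θ θ')

/-- Consistency: expected failures `o(t^δ)` for all `0 < δ < 1`. -/
def Consistent (π : Policy K) : Prop :=
  ∀ δ ∈ Set.Ioo (0 : ℝ) 1, B.ConsistentWith δ π

/-- The number of the first `t` rounds in which `k` is pulled while `j` is optimal. -/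
def pulls (θ : Fin K → Θ) (ω : Play K) (t : ℕ) (k j : Fin K) : ℕ :=
  ((Finset.range t).filter fun n => (ω n).1 = k ∧ B.opt θ n (ω.hist n) = j).card

/-- `M(θ')`: the asymptotic average of the Kullback-Leibler divergences per failure. -/
def rate (θ : Fin K → Θ) (θ' : Fin K → Fin K → Θ) (ω : Play K) : ℝ≥0∞ :=
  limsup (fun t : ℕ =>
    (∑ k, ∑ j, (B.pulls θ ω t k j : ℝ≥0∞) *
      InformationTheory.klDiv (B.f (θ k)) (B.f (θ' k j))) /
        (B.failures (B.stationary θ) ω t : ℝ≥0∞)) atTop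

/-- The infimum of `M(θ')` over all admissible modified parameter sets. -/
def infRate (π : Policy K) (θ : Fin K → Θ) (ω : Play K) : ℝ≥0∞ :=
  ⨅ (θ' : Fin K → Fin K → Θ) (_ : B.Admissible π θ θ'), B.rate θ θ' ω

end BanditModel

end

/-! Fix an admissible `θ'` and let `N`, `N'` count the failures in the original and in the modified
problem. The originally optimal arm is suboptimal in the modified problem, so almost surely every
round is a failure in one of the two: `t ≤ N(t) + N'(t)` (`ae_le_failures_add`). If `N(t) ≤ C log
t`, then `N'(t) ≥ t/2` for large `t`, and by consistency and Markov's inequality this has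
probability at most `2 t^(δ-1)` under the modified law. Passing back to the original law costs a
factor `exp L_t`, where `L_t` is the log-likelihood ratio of the rewards. Hence the event `N(t) ≤ C
log t`, `L_t ≤ a log t` has probability at most `2 t^(a+δ-1)` (`eventually_measure_le`). For `a < 1
- δ` this is summable along `t = 2^i`, and Borel–Cantelli shows that few failures force `L_t > a log
t` (`ae_eventually_lt_logLik`).

On the other hand, a strong law for the rewards of each pair (pulled arm, optimal arm) bounds `L_t`
by `∑ N_{k,j}(t) KL_{k,j} + ε N(t) + O(1)` (`ae_exists_logLik_le`). The error is proportional to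
`N(t)`, not to `t`, because pulls of the optimal arm contribute nothing. If `c' M(θ') < 1 - δ`, the
two bounds contradict `N(t) ≤ c' log t` at large powers of two, and monotonicity of `N` fills the
gaps (`eventually_mul_log_lt`).

The infimum over `θ'` runs over a possibly uncountable set. Only the matrix of divergences matters,
and a countable dense set of such matrices yields one null set for all `θ'`
(`ae_forall_admissible_eventually_lt_cost`). -/

/-! ### Conditional laws of single rounds and change of measure for plays. -/

namespace Play

variable {K : ℕ}

theorem measurable_hist (n : ℕ) : Measurable fun ω : Play K => ω.hist n :=
  measurable_pi_lambda _ fun _ => measurable_pi_apply _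

theorem hist_succ (ω : Play K) (n : ℕ) :
    ω.hist (n + 1) = Fin.snoc (α := fun _ => Fin K × ℝ) (ω.hist n) (ω n) := by
  ext1 i
  refine Fin.lastCases ?_ (fun i => ?_) i <;> simp [hist]

end Play

theorem measurable_snoc {α : Type*} [MeasurableSpace α] (n : ℕ) :
    Measurable fun p : (Fin n → α) × α => (Fin.snoc (α := fun _ => α) p.1 p.2 : Fin (n + 1) → α) := by
  refine measurable_pi_lambda _ fun i => ?_
  refine Fin.lastCases ?_ (fun i => ?_) i
  · simpa using measurable_snd
  · simp only [Fin.snoc_castSucc]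
    exact (measurable_pi_apply i).comp measurable_fst

namespace BanditModel

variable {K : ℕ} {Θ : Type*} (B : BanditModel K Θ)

theorem map_eval_zero_law (E : B.Instance) (π : Policy K) :
    (B.law E π).map (fun ω => ω 0) = B.stepKernel E π 0 Fin.elim0 := by
  have hfr : (B.law E π).map (Preorder.frestrictLe 0) =
      (B.stepKernel E π 0 Fin.elim0).map
        (MeasurableEquiv.piUnique (fun _ : Finset.Iic 0 => Fin K × ℝ)).symm := by
    unfold law Kernel.trajMeasure
    rw [Measure.map_comp _ _ (by fun_prop), Kernel.traj_map_frestrictLe, Kernel.partialTraj_self,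
      Measure.id_comp]
  have he : (fun ω : Play K => ω 0) =
      (fun x : (i : Finset.Iic 0) → Fin K × ℝ => x ⟨0, by simp⟩) ∘
        (Preorder.frestrictLe (π := fun _ : ℕ => Fin K × ℝ) 0) := by
    ext1 ω; rfl
  rw [he, ← Measure.map_map (by fun_prop) (by fun_prop), hfr, Measure.map_map (by fun_prop)
    (MeasurableEquiv.measurable _)]
  exact Measure.map_id

/-- The conditional law of a round given the history before it. -/
theorem lintegral_law_step (E : B.Instance) (π : Policy K) (n : ℕ)
    {G : Hist K n → Fin K × ℝ → ℝ≥0∞} (hG : Measurable (Function.uncurry G)) :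
    ∫⁻ ω, G (ω.hist n) (ω n) ∂B.law E π =
      ∫⁻ ω, ∫⁻ y, G (ω.hist n) y ∂B.stepKernel E π n (ω.hist n) ∂B.law E π := by
  cases n with
  -- `Kernel.trajMeasure` draws coordinate 0 from an initial measure and not from a kernel, so it is
  -- treated apart.
  | zero =>
    have h0 : ∀ h : Hist K 0, h = Fin.elim0 := fun h => Subsingleton.elim _ _
    simp only [fun ω : Play K => h0 (ω.hist 0), lintegral_const, measure_univ, mul_one]
    have hG0 : Measurable (G Fin.elim0) := hG.comp measurable_prodMk_left
    rw [← map_eval_zero_law, lintegral_map hG0 (by fun_prop)]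
  | succ n =>
    have key := Kernel.map_frestrictLe_trajMeasure_compProd_eq_map_trajMeasure
      (X := fun _ : ℕ => Fin K × ℝ) (μ₀ := B.stepKernel E π 0 Fin.elim0)
      (κ := fun n => (B.stepKernel E π (n + 1)).comap (toHist n) (measurable_toHist n)) (a := n)
    change (B.law E π).map _ ⊗ₘ _ = (B.law E π).map _ at key
    let F : ((i : Finset.Iic n) → Fin K × ℝ) × (Fin K × ℝ) → ℝ≥0∞ := fun p => G (toHist n p.1) p.2
    have hF : Measurable F :=
      hG.comp (((measurable_toHist n).comp measurable_fst).prodMk measurable_snd)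
    have h1 := lintegral_map (μ := B.law E π) hF
      (g := fun x => (Preorder.frestrictLe (π := fun _ : ℕ => Fin K × ℝ) n x, x (n + 1)))
      (by fun_prop)
    rw [← key, Measure.lintegral_compProd hF,
      lintegral_map (hF.lintegral_kernel_prod_right') (by fun_prop)] at h1
    exact h1.symm

theorem lintegral_stepKernel (E : B.Instance) (π : Policy K) (n : ℕ) (h : Hist K n)
    {G : Fin K × ℝ → ℝ≥0∞} (hG : Measurable G) :
    ∫⁻ y, G y ∂B.stepKernel E π n h =
      ∫⁻ a, ∫⁻ x, G (a, x) ∂B.f (E.param n h a) ∂π.armKernel n h := by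
  unfold stepKernel
  rw [Kernel.lintegral_compProd _ _ _ hG]
  rfl

theorem measurable_lintegral_stepKernel (E : B.Instance) (π : Policy K) (n : ℕ)
    {G : Hist K n → Fin K × ℝ → ℝ≥0∞} (hG : Measurable (Function.uncurry G)) :
    Measurable fun h => ∫⁻ y, G h y ∂B.stepKernel E π n h :=
  hG.lintegral_kernel_prod_right (κ := B.stepKernel E π n)

/-- A change of measure: if one round of `E`, weighted with `w`, is dominated by one round of `E'`,
then the same holds for plays of `t` rounds, weighted with the product of the weights. -/
theorem lintegral_law_mul_prod_le (E E' : B.Instance) (π : Policy K)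
    (w : ∀ n, Hist K n → Fin K × ℝ → ℝ≥0∞) (hw : ∀ n, Measurable (Function.uncurry (w n)))
    (hle : ∀ n h a (G : ℝ → ℝ≥0∞), Measurable G →
      ∫⁻ x, G x * w n h (a, x) ∂B.f (E.param n h a) ≤ ∫⁻ x, G x ∂B.f (E'.param n h a))
    (t : ℕ) (G : Hist K t → ℝ≥0∞) (hG : Measurable G) :
    ∫⁻ ω, G (ω.hist t) * ∏ n ∈ Finset.range t, w n (ω.hist n) (ω n) ∂B.law E π ≤
      ∫⁻ ω, G (ω.hist t) ∂B.law E' π := by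
  -- The product of the weights, rewritten as a function of the finite history, so that the last
  -- round can be integrated out.
  let Z : ∀ t, Hist K t → ℝ≥0∞ := fun t =>
    Nat.rec (motive := fun t => Hist K t → ℝ≥0∞) (fun _ => 1) (fun n z h =>
      z (Fin.init h) * w n (Fin.init (α := fun _ => Fin K × ℝ) h) (h (Fin.last n))) t
  have hZs : ∀ n (h : Hist K n) y, Z (n + 1) (Fin.snoc (α := fun _ => Fin K × ℝ) h y) =
      Z n h * w n h y := by
    intro n h y
    change Z n (Fin.init (α := fun _ => Fin K × ℝ) _) *
      w n (Fin.init (α := fun _ => Fin K × ℝ) _) _ = _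
    rw [Fin.init_snoc, Fin.snoc_last]
  have hinit : ∀ n, Measurable fun h : Hist K (n + 1) => (Fin.init h : Hist K n) := fun n =>
    measurable_pi_lambda _ fun _ => measurable_pi_apply _
  have hZm : ∀ n, Measurable (Z n) := by
    intro n
    induction n with
    | zero => exact measurable_const
    | succ n ih =>
      exact (ih.comp (hinit n)).mul ((hw n).comp ((hinit n).prodMk (measurable_pi_apply _)))
  have hZp : ∀ n (ω : Play K), Z n (ω.hist n) =
      ∏ i ∈ Finset.range n, w i (ω.hist i) (ω i) := by
    intro n ω
    induction n with
    | zero => rfl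
    | succ n ih => rw [Play.hist_succ, hZs, ih, Finset.prod_range_succ]
  simp_rw [← hZp]
  induction t with
  | zero =>
    have h0 : ∀ ω : Play K, ω.hist 0 = Fin.elim0 := fun h => Subsingleton.elim _ _
    have h1 : Z 0 Fin.elim0 = 1 := rfl
    simp [h0, h1]
  | succ t ih =>
    have hGs : Measurable fun p : Hist K t × (Fin K × ℝ) =>
      G (Fin.snoc (α := fun _ => Fin K × ℝ) p.1 p.2) := hG.comp (measurable_snoc t)
    simp_rw [Play.hist_succ, hZs]
    rw [B.lintegral_law_step E π t
        (G := fun h y => G (Fin.snoc (α := fun _ => Fin K × ℝ) h y) * (Z t h * w t h y))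
        (hGs.mul (((hZm t).comp measurable_fst).mul (hw t))),
      B.lintegral_law_step E' π t
        (G := fun h y => G (Fin.snoc (α := fun _ => Fin K × ℝ) h y)) hGs]
    -- The last round under `E'` is absorbed into the test function: the induction hypothesis is
    -- applied to the conditional expectation of `G` given the first `t` rounds.
    refine le_trans (lintegral_mono fun ω => ?_) (ih _
      (B.measurable_lintegral_stepKernel E' π t
        (G := fun h y => G (Fin.snoc (α := fun _ => Fin K × ℝ) h y)) hGs))
    set h := ω.hist t
    have hGh : Measurable fun y => G (Fin.snoc (α := fun _ => Fin K × ℝ) h y) :=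
      hGs.comp measurable_prodMk_left
    have hwh : Measurable (w t h) := (hw t).comp measurable_prodMk_left
    simp_rw [mul_left_comm _ (Z t h)]
    have hGw : Measurable fun y => G (Fin.snoc (α := fun _ => Fin K × ℝ) h y) * w t h y :=
      hGh.mul hwh
    rw [lintegral_const_mul _ hGw, mul_comm (Z t h)]
    gcongr ?_ * _
    rw [lintegral_stepKernel _ _ _ _ _ hGw, lintegral_stepKernel _ _ _ _ _ hGh]
    exact lintegral_mono fun a => hle t h a _ (hGh.comp measurable_prodMk_left)

end BanditModel

/-! ### Independent sequences and their strong law. -/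

/-- The sequence `s` with `x` put in front. -/
def consSeq (x : ℝ) (s : ℕ → ℝ) : ℕ → ℝ := fun n => Nat.casesOn n x s

theorem measurable_consSeq : Measurable fun p : ℝ × (ℕ → ℝ) => consSeq p.1 p.2 := by
  refine measurable_pi_lambda _ fun n => ?_
  cases n with
  | zero => exact measurable_fst
  | succ n => exact (measurable_pi_apply n).comp measurable_snd

theorem map_consSeq (μ : Measure ℝ) [IsProbabilityMeasure μ] :
    (μ.prod (Measure.infinitePi fun _ : ℕ => μ)).map (fun p => consSeq p.1 p.2) =
      Measure.infinitePi fun _ : ℕ => μ := by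
  refine Measure.eq_infinitePi _ fun I T hT => ?_
  have hsub : I ⊆ Finset.range (I.sup id + 1) := fun i hi =>
    Finset.mem_range.2 (Nat.lt_succ_of_le (Finset.le_sup (f := id) hi))
  set N := I.sup id
  -- Padding with `Set.univ` makes the box range over an initial segment of indices, which splits
  -- into coordinate 0 and a shifted box.
  let T' : ℕ → Set ℝ := fun i => if i ∈ I then T i else Set.univ
  have hT' : ∀ i, MeasurableSet (T' i) := fun i => by
    by_cases h : i ∈ I <;> simp [T', h, hT]
  have hpi : Set.pi (I : Set ℕ) T = Set.pi (Finset.range (N + 1) : Set ℕ) T' := by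
    ext s
    simp only [Set.mem_pi, Finset.mem_coe]
    refine ⟨fun h i _ => ?_, fun h i hi => by simpa [T', hi] using h i (hsub hi)⟩
    by_cases hi : i ∈ I <;> simp [T', hi, h]
  have hpre : (fun p : ℝ × (ℕ → ℝ) => consSeq p.1 p.2) ⁻¹' Set.pi (Finset.range (N + 1) : Set ℕ) T' =
      T' 0 ×ˢ Set.pi (Finset.range N : Set ℕ) fun i => T' (i + 1) := by
    ext ⟨x, s⟩
    simp only [Set.mem_preimage, Set.mem_pi, Finset.coe_range, Set.mem_Iio, Set.mem_prod]
    refine ⟨fun h => ⟨h 0 (by omega), fun i hi => h (i + 1) (by omega)⟩, fun h i hi => ?_⟩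
    cases i with
    | zero => exact h.1
    | succ i => exact h.2 i (by omega)
  rw [hpi, Measure.map_apply measurable_consSeq
    (MeasurableSet.pi (Finset.countable_toSet _) fun i _ => hT' i), hpre, Measure.prod_prod,
    Measure.infinitePi_pi _ fun i _ => hT' _]
  rw [mul_comm, ← Finset.prod_range_succ' (fun i => μ (T' i)) N]
  rw [← Finset.prod_subset hsub fun i _ hi => by simp [T', hi]]
  exact Finset.prod_congr rfl fun i hi => by simp [T', hi]

theorem lintegral_consSeq (μ : Measure ℝ) [IsProbabilityMeasure μ] {g : (ℕ → ℝ) → ℝ≥0∞}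
    (hg : Measurable g) :
    ∫⁻ x, ∫⁻ s, g (consSeq x s) ∂Measure.infinitePi (fun _ : ℕ => μ) ∂μ =
      ∫⁻ s, g s ∂Measure.infinitePi fun _ : ℕ => μ := by
  conv_rhs => rw [← map_consSeq μ, lintegral_map hg measurable_consSeq]
  have hgc : Measurable fun p : ℝ × (ℕ → ℝ) => g (consSeq p.1 p.2) := hg.comp measurable_consSeq
  rw [lintegral_prod _ hgc.aemeasurable]

theorem measurableSet_exists_sum_gt {ℓ : ℝ → ℝ} (hℓ : Measurable ℓ) (m C : ℝ) :
    MeasurableSet {s : ℕ → ℝ | ∃ n : ℕ, m * n + C < ∑ i ∈ Finset.range n, ℓ (s i)} := by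
  have : {s : ℕ → ℝ | ∃ n : ℕ, m * n + C < ∑ i ∈ Finset.range n, ℓ (s i)} =
      ⋃ n : ℕ, {s | m * n + C < ∑ i ∈ Finset.range n, ℓ (s i)} := by
    ext s; simp
  rw [this]
  exact MeasurableSet.iUnion fun n => measurableSet_lt measurable_const (by fun_prop)

theorem ae_exists_sum_le_infinitePi (μ : Measure ℝ) [IsProbabilityMeasure μ] {ℓ : ℝ → ℝ}
    (hℓ : Measurable ℓ) (hi : Integrable ℓ μ) {ε : ℝ} (hε : 0 < ε) :
    ∀ᵐ s ∂Measure.infinitePi fun _ : ℕ => μ, ∃ C : ℕ, ∀ n : ℕ,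
      ∑ i ∈ Finset.range n, ℓ (s i) ≤ (∫ x, ℓ x ∂μ + ε) * n + C := by
  have hmp : ∀ i : ℕ, MeasurePreserving (fun s : ℕ → ℝ => s i)
      (Measure.infinitePi fun _ : ℕ => μ) μ := fun i => measurePreserving_eval_infinitePi _ i
  have hid : ∀ i, IdentDistrib (fun s : ℕ → ℝ => ℓ (s i)) (fun s : ℕ → ℝ => ℓ (s 0))
      (Measure.infinitePi fun _ : ℕ => μ) (Measure.infinitePi fun _ : ℕ => μ) := fun i =>
    IdentDistrib.comp (u := ℓ) ⟨(hmp i).aemeasurable, (hmp 0).aemeasurable,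
      by rw [(hmp i).map_eq, (hmp 0).map_eq]⟩ hℓ
  have hint : ∫ s, ℓ (s 0) ∂(Measure.infinitePi fun _ : ℕ => μ) = ∫ x, ℓ x ∂μ := by
    rw [← (hmp 0).map_eq, integral_map (hmp 0).aemeasurable hℓ.aestronglyMeasurable, (hmp 0).map_eq]
  have key := strong_law_ae_real (μ := Measure.infinitePi fun _ : ℕ => μ)
    (fun i s => ℓ (s i)) ((hmp 0).integrable_comp_of_integrable hi)
    (fun i j hij => (iIndepFun_infinitePi (P := fun _ : ℕ => μ) (X := fun _ => ℓ)
      fun _ => hℓ).indepFun hij) hid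
  rw [hint] at key
  filter_upwards [key] with s hs
  have hev : ∀ᶠ n : ℕ in atTop,
      ∑ i ∈ Finset.range n, ℓ (s i) ≤ (∫ x, ℓ x ∂μ + ε) * n := by
    filter_upwards [hs.eventually_lt_const (lt_add_of_pos_right _ hε), eventually_gt_atTop 0]
      with n hn h0
    exact ((div_lt_iff₀ (by exact_mod_cast h0)).1 hn).le
  -- The strong law gives the bound only from some `n₀` on; the constant `C` pays for the finitely
  -- many earlier `n`.
  obtain ⟨n₀, hn₀⟩ := eventually_atTop.1 hev
  let b : ℕ → ℝ := fun n => |∑ i ∈ Finset.range n, ℓ (s i) - (∫ x, ℓ x ∂μ + ε) * n|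
  obtain ⟨C, hC⟩ := exists_nat_ge (∑ n ∈ Finset.range n₀, b n)
  refine ⟨C, fun n => ?_⟩
  have hC0 : (0 : ℝ) ≤ C := C.cast_nonneg
  rcases le_or_gt n₀ n with h | h
  · linarith [hn₀ n h]
  · have h1 := Finset.single_le_sum (f := b) (fun i _ => abs_nonneg _) (Finset.mem_range.2 h)
    have h2 := le_abs_self (∑ i ∈ Finset.range n, ℓ (s i) - (∫ x, ℓ x ∂μ + ε) * n)
    change |_| ≤ _ at h1
    linarith

/-! ### A strong law for rewards in rounds selected by the history. -/

section Stream

variable {K : ℕ} (H : ∀ n, Hist K n → Fin K → Prop)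

open Classical in
/-- The rewards in the rounds selected by `H`, in their order, followed by the sequence `s`. -/
noncomputable def rewardStream : ∀ t, Hist K t → (ℕ → ℝ) → ℕ → ℝ
  | 0, _, s => s
  | t + 1, h, s => rewardStream t (Fin.init h)
      (if H t (Fin.init h) (h (Fin.last t)).1 then consSeq (h (Fin.last t)).2 s else s)

open Classical in
/-- The number of the first `t` rounds that `H` selects. -/
noncomputable def selCount (ω : Play K) (t : ℕ) : ℕ :=
  ((Finset.range t).filter fun n => H n (ω.hist n) (ω n).1).card

open Classical in
/-- The sum of `ℓ` over the rewards in the rounds selected by `H`. -/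
noncomputable def selSum (ℓ : ℝ → ℝ) (ω : Play K) (t : ℕ) : ℝ :=
  ∑ n ∈ (Finset.range t).filter fun n => H n (ω.hist n) (ω n).1, ℓ (ω n).2

variable {H}

open Classical in
theorem rewardStream_hist_succ (ω : Play K) (t : ℕ) (s : ℕ → ℝ) :
    rewardStream H (t + 1) (ω.hist (t + 1)) s = rewardStream H t (ω.hist t)
      (if H t (ω.hist t) (ω t).1 then consSeq (ω t).2 s else s) := rfl

open Classical in
theorem rewardStream_snoc (t : ℕ) (h : Hist K t) (y : Fin K × ℝ) (s : ℕ → ℝ) :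
    rewardStream H (t + 1) (Fin.snoc (α := fun _ => Fin K × ℝ) h y) s = rewardStream H t h
      (if H t h y.1 then consSeq y.2 s else s) := by
  simp [rewardStream, Fin.init_snoc, Fin.snoc_last]

theorem selCount_succ_of_sel {ω : Play K} {t : ℕ} (h : H t (ω.hist t) (ω t).1) :
    selCount H ω (t + 1) = selCount H ω t + 1 := by
  simp [selCount, Finset.range_add_one, Finset.filter_insert, h]

theorem selCount_succ_of_not {ω : Play K} {t : ℕ} (h : ¬H t (ω.hist t) (ω t).1) :
    selCount H ω (t + 1) = selCount H ω t := by
  simp [selCount, Finset.range_add_one, Finset.filter_insert, h]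

theorem selSum_succ_of_sel {ℓ : ℝ → ℝ} {ω : Play K} {t : ℕ} (h : H t (ω.hist t) (ω t).1) :
    selSum H ℓ ω (t + 1) = selSum H ℓ ω t + ℓ (ω t).2 := by
  simp [selSum, Finset.range_add_one, Finset.filter_insert, h, add_comm]

theorem selSum_succ_of_not {ℓ : ℝ → ℝ} {ω : Play K} {t : ℕ} (h : ¬H t (ω.hist t) (ω t).1) :
    selSum H ℓ ω (t + 1) = selSum H ℓ ω t := by
  simp [selSum, Finset.range_add_one, Finset.filter_insert, h]

theorem rewardStream_selCount_add (ω : Play K) (t : ℕ) (s : ℕ → ℝ) (i : ℕ) :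
    rewardStream H t (ω.hist t) s (selCount H ω t + i) = s i := by
  induction t generalizing s i with
  | zero => simp [rewardStream, selCount]
  | succ t ih =>
    rw [rewardStream_hist_succ]
    by_cases h : H t (ω.hist t) (ω t).1
    · rw [if_pos h, selCount_succ_of_sel h, add_assoc, ih, add_comm]
      rfl
    · rw [if_neg h, selCount_succ_of_not h, ih]

/-- Every selected sum up to a time `u ≤ t` is a partial sum of one and the same stream, so
deviations at all these times are read off a single sequence. -/
theorem sum_rewardStream (ℓ : ℝ → ℝ) (ω : Play K) (t : ℕ) (s : ℕ → ℝ) {u : ℕ} (hu : u ≤ t) :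
    ∑ i ∈ Finset.range (selCount H ω u), ℓ (rewardStream H t (ω.hist t) s i) =
      selSum H ℓ ω u := by
  induction t generalizing s u with
  | zero =>
    obtain rfl : u = 0 := by omega
    simp [selCount, selSum]
  | succ t ih =>
    rw [rewardStream_hist_succ]
    rcases Nat.lt_or_ge t u with h | h
    · obtain rfl : u = t + 1 := by omega
      by_cases h : H t (ω.hist t) (ω t).1
      · rw [selCount_succ_of_sel h, selSum_succ_of_sel h, Finset.sum_range_succ, ih _ le_rfl]
        have := rewardStream_selCount_add (H := H) ω t (consSeq (ω t).2 s) 0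
        rw [if_pos h, ← add_zero (selCount H ω t), this]
        rfl
      · rw [selCount_succ_of_not h, selSum_succ_of_not h, ih _ le_rfl]
    · exact ih _ h

theorem measurable_rewardStream
    (hH : ∀ n, MeasurableSet {p : Hist K n × Fin K | H n p.1 p.2}) (t : ℕ) :
    Measurable fun p : Hist K t × (ℕ → ℝ) => rewardStream H t p.1 p.2 := by
  classical
  induction t with
  | zero => exact measurable_snd
  | succ t ih =>
    have hi : Measurable fun p : Hist K (t + 1) × (ℕ → ℝ) => (Fin.init p.1 : Hist K t) :=
      measurable_pi_lambda _ fun i => (measurable_pi_apply i.castSucc).comp measurable_fst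
    have hl : Measurable fun p : Hist K (t + 1) × (ℕ → ℝ) => p.1 (Fin.last t) :=
      (measurable_pi_apply _).comp measurable_fst
    refine ih.comp (hi.prodMk (Measurable.ite ?_ ?_ measurable_snd))
    · exact (hi.prodMk hl.fst) (hH t)
    · exact measurable_consSeq.comp (hl.snd.prodMk measurable_snd)

end Stream

namespace BanditModel

variable {K : ℕ} {Θ : Type*} (B : BanditModel K Θ) {H : ∀ n, Hist K n → Fin K → Prop}

/-- If all selected rewards have the law `μ`, then the selected rewards of a play, followed by
independent draws from `μ`, are independent draws from `μ`. -/
theorem lintegral_rewardStream (E : B.Instance) (π : Policy K)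
    (hH : ∀ n, MeasurableSet {p : Hist K n × Fin K | H n p.1 p.2})
    (μ : Measure ℝ) [IsProbabilityMeasure μ]
    (hμ : ∀ n h a, H n h a → B.f (E.param n h a) = μ) (t : ℕ) {g : (ℕ → ℝ) → ℝ≥0∞}
    (hg : Measurable g) :
    ∫⁻ ω, ∫⁻ s, g (rewardStream H t (ω.hist t) s) ∂Measure.infinitePi (fun _ : ℕ => μ)
      ∂B.law E π = ∫⁻ s, g s ∂Measure.infinitePi fun _ : ℕ => μ := by
  classical
  induction t with
  | zero => simp [rewardStream]
  | succ t ih =>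
    have hGm : Measurable fun p : (Hist K t × (Fin K × ℝ)) × (ℕ → ℝ) =>
        g (rewardStream H (t + 1) (Fin.snoc (α := fun _ => Fin K × ℝ) p.1.1 p.1.2) p.2) :=
      hg.comp ((measurable_rewardStream hH (t + 1)).comp
        (((measurable_snoc t).comp measurable_fst).prodMk measurable_snd))
    have hG := hGm.lintegral_prod_right' (ν := Measure.infinitePi (fun _ : ℕ => μ))
    simp_rw [Play.hist_succ]
    rw [B.lintegral_law_step E π t (G := fun h y => ∫⁻ s, g (rewardStream H (t + 1)
      (Fin.snoc (α := fun _ => Fin K × ℝ) h y) s) ∂Measure.infinitePi (fun _ : ℕ => μ)) hG, ← ih]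
    refine lintegral_congr fun ω => ?_
    set h := ω.hist t
    rw [B.lintegral_stepKernel E π t h (G := fun y => ∫⁻ s, g (rewardStream H (t + 1)
      (Fin.snoc (α := fun _ => Fin K × ℝ) h y) s) ∂Measure.infinitePi (fun _ : ℕ => μ))
      (hG.comp measurable_prodMk_left)]
    have hgh : Measurable fun s => g (rewardStream H t h s) :=
      hg.comp ((measurable_rewardStream hH t).comp measurable_prodMk_left)
    have hc : ∀ a, ∫⁻ x, ∫⁻ s, g (rewardStream H (t + 1)
        (Fin.snoc (α := fun _ => Fin K × ℝ) h (a, x)) s) ∂Measure.infinitePi (fun _ : ℕ => μ)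
          ∂B.f (E.param t h a) =
        ∫⁻ s, g (rewardStream H t h s) ∂Measure.infinitePi (fun _ : ℕ => μ) := by
      intro a
      have := B.isProbabilityMeasure_f (E.param t h a)
      simp_rw [rewardStream_snoc]
      by_cases ha : H t h a
      · simp only [ha, if_true]
        rw [hμ t h a ha]
        exact lintegral_consSeq μ hgh
      · simp [ha]
    simp_rw [hc]
    simp

/-- The number of selected rounds is random and may stay bounded, so the strong law does not apply
directly. Completing the selected rewards with fresh draws gives a genuinely independent sequence,
in which each deviation of a selected sum reappears. -/
theorem measure_exists_selSum_gt_le (E : B.Instance) (π : Policy K)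
    (hH : ∀ n, MeasurableSet {p : Hist K n × Fin K | H n p.1 p.2})
    (μ : Measure ℝ) [IsProbabilityMeasure μ]
    (hμ : ∀ n h a, H n h a → B.f (E.param n h a) = μ) {ℓ : ℝ → ℝ} (hℓ : Measurable ℓ) (m C : ℝ) :
    B.law E π {ω | ∃ t, m * selCount H ω t + C < selSum H ℓ ω t} ≤
      Measure.infinitePi (fun _ : ℕ => μ)
        {s | ∃ n : ℕ, m * n + C < ∑ i ∈ Finset.range n, ℓ (s i)} := by
  set bad : Set (ℕ → ℝ) := {s | ∃ n : ℕ, m * n + C < ∑ i ∈ Finset.range n, ℓ (s i)}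
  have hbad : MeasurableSet bad := measurableSet_exists_sum_gt hℓ m C
  have hun : {ω : Play K | ∃ t, m * selCount H ω t + C < selSum H ℓ ω t} =
      ⋃ T, {ω | ∃ t ≤ T, m * selCount H ω t + C < selSum H ℓ ω t} := by
    ext ω
    simp only [Set.mem_ofPred_eq, Set.mem_iUnion]
    exact ⟨fun ⟨t, ht⟩ => ⟨t, t, le_rfl, ht⟩, fun ⟨_, t, _, ht⟩ => ⟨t, ht⟩⟩
  have hmono : Monotone fun T : ℕ =>
      {ω : Play K | ∃ t ≤ T, m * selCount H ω t + C < selSum H ℓ ω t} :=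
    fun T T' hT ω ⟨t, ht, h⟩ => ⟨t, ht.trans hT, h⟩
  rw [hun, hmono.measure_iUnion]
  refine iSup_le fun T => ?_
  have hgm : Measurable (bad.indicator (1 : (ℕ → ℝ) → ℝ≥0∞)) := measurable_one.indicator hbad
  have hFm : Measurable fun ω : Play K => ∫⁻ s, bad.indicator 1 (rewardStream H T (ω.hist T) s)
      ∂Measure.infinitePi (fun _ : ℕ => μ) :=
    Measurable.lintegral_prod_right' (f := fun p : Play K × (ℕ → ℝ) =>
      bad.indicator (1 : (ℕ → ℝ) → ℝ≥0∞) (rewardStream H T (p.1.hist T) p.2))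
      (hgm.comp ((measurable_rewardStream hH T).comp
        (((Play.measurable_hist T).comp measurable_fst).prodMk measurable_snd)))
  rw [← lintegral_indicator_one hbad, ← B.lintegral_rewardStream E π hH μ hμ T hgm]
  refine le_trans (measure_mono fun ω hω => ?_) (le_of_eq_of_le (one_mul _).symm
    (mul_meas_ge_le_lintegral hFm 1))
  obtain ⟨t, ht, h⟩ := hω
  -- The deviation lies in the part of the stream made of actual rewards, hence it is there for
  -- every filler `s`.
  have : ∀ s, rewardStream H T (ω.hist T) s ∈ bad := fun s =>
    ⟨selCount H ω t, by rw [sum_rewardStream ℓ ω T s ht]; exact h⟩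
  simp [this]

/-- The upper half of a strong law of large numbers for the rewards in the selected rounds. -/
theorem ae_exists_selSum_le (E : B.Instance) (π : Policy K)
    (hH : ∀ n, MeasurableSet {p : Hist K n × Fin K | H n p.1 p.2})
    (μ : Measure ℝ) [IsProbabilityMeasure μ]
    (hμ : ∀ n h a, H n h a → B.f (E.param n h a) = μ) {ℓ : ℝ → ℝ} (hℓ : Measurable ℓ)
    (hi : Integrable ℓ μ) {ε : ℝ} (hε : 0 < ε) :
    ∀ᵐ ω ∂B.law E π, ∃ C : ℕ, ∀ t,
      selSum H ℓ ω t ≤ (∫ x, ℓ x ∂μ + ε) * selCount H ω t + C := by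
  set m := ∫ x, ℓ x ∂μ + ε
  let bad : ℕ → Set (ℕ → ℝ) := fun C =>
    {s | ∃ n : ℕ, m * n + C < ∑ i ∈ Finset.range n, ℓ (s i)}
  have hbad : ∀ C, MeasurableSet (bad C) := fun C => measurableSet_exists_sum_gt hℓ m C
  have hanti : Antitone bad := fun C C' h s ⟨n, hn⟩ =>
    ⟨n, lt_of_le_of_lt (by gcongr) hn⟩
  have hzero : Measure.infinitePi (fun _ : ℕ => μ) (⋂ C, bad C) = 0 := by
    have := ae_exists_sum_le_infinitePi μ hℓ hi hε
    rw [ae_iff] at this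
    refine measure_mono_null (fun s hs => ?_) this
    simp only [Set.mem_iInter] at hs
    simp only [Set.mem_ofPred_eq, not_exists, not_forall, not_le]
    exact hs
  -- Continuity from above: the events `bad C` decrease to a null set, and each of them bounds the
  -- exceptional probability.
  have hlim := tendsto_measure_iInter_atTop (μ := Measure.infinitePi (fun _ : ℕ => μ))
    (fun C => (hbad C).nullMeasurableSet) hanti ⟨0, measure_ne_top _ _⟩
  rw [hzero] at hlim
  rw [ae_iff]
  refine le_antisymm (ge_of_tendsto' hlim fun C => ?_) zero_le
  refine le_trans (measure_mono fun ω hω => ?_)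
    (B.measure_exists_selSum_gt_le E π hH μ hμ hℓ m C)
  simp only [Set.mem_ofPred_eq, not_exists, not_forall, not_le] at hω ⊢
  exact hω C
  
end BanditModel

/-! ### Likelihood ratios and the improbability of few failures. -/

/-- The weight is the density of `ν` with respect to `μ`. Only an inequality holds, since the part
of `ν` singular to `μ` is lost. -/
theorem lintegral_mul_exp_neg_llr_le {α : Type*} [MeasurableSpace α] (μ ν : Measure α)
    [SigmaFinite μ] [SigmaFinite ν] (h : μ ≪ ν) {G : α → ℝ≥0∞} (hG : Measurable G) :
    ∫⁻ x, G x * ENNReal.ofReal (Real.exp (-llr μ ν x)) ∂μ ≤ ∫⁻ x, G x ∂ν := by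
  calc ∫⁻ x, G x * ENNReal.ofReal (Real.exp (-llr μ ν x)) ∂μ
      = ∫⁻ x, ν.rnDeriv μ x * G x ∂μ := by
        refine lintegral_congr_ae ?_
        filter_upwards [exp_neg_llr h, ν.rnDeriv_lt_top μ] with x hx hx'
        rw [hx, ENNReal.ofReal_toReal hx'.ne, mul_comm]
    _ = ∫⁻ x, G x ∂μ.withDensity (ν.rnDeriv μ) :=
        (lintegral_withDensity_eq_lintegral_mul _ (Measure.measurable_rnDeriv _ _) hG).symm
    _ ≤ ∫⁻ x, G x ∂ν := lintegral_mono' (Measure.withDensity_rnDeriv_le _ _) le_rfl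

/-- The play that continues the history `h` in a fixed way. -/
def Hist.extend {K t : ℕ} [NeZero K] (h : Hist K t) : Play K :=
  fun n => if hn : n < t then h ⟨n, hn⟩ else (0, 0)

namespace Hist

variable {K t : ℕ} [NeZero K]

theorem measurable_extend : Measurable (extend : Hist K t → Play K) := by
  refine measurable_pi_lambda _ fun n => ?_
  by_cases hn : n < t
  · simpa [extend, hn] using measurable_pi_apply (X := fun _ : Fin t => Fin K × ℝ) ⟨n, hn⟩
  · simp [extend, hn]

theorem extend_hist_apply (ω : Play K) {n : ℕ} (hn : n < t) : (ω.hist t).extend n = ω n := by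
  simp [extend, hn, Play.hist]

theorem hist_extend_hist (ω : Play K) {n : ℕ} (hn : n ≤ t) :
    (ω.hist t).extend.hist n = ω.hist n := by
  ext1 i
  exact extend_hist_apply ω (lt_of_lt_of_le i.2 hn)

end Hist

namespace BanditModel

variable {K : ℕ} {Θ : Type*} (B : BanditModel K Θ)

theorem failures_mono (E : B.Instance) (ω : Play K) : Monotone (B.failures E ω) := by
  classical
  exact fun _ _ h => Finset.card_le_card (Finset.filter_subset_filter _ (Finset.range_mono h))

theorem failures_le (E : B.Instance) (ω : Play K) (t : ℕ) : B.failures E ω t ≤ t := by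
  classical
  exact (Finset.card_filter_le _ _).trans_eq (Finset.card_range t)

theorem measurableSet_isFailure (E : B.Instance)
    (hE : ∀ n, Measurable fun h => B.z n (E.param n h) h) (n : ℕ) :
    MeasurableSet {ω | B.IsFailure E ω n} := by
  have hv : Measurable fun ω : Play K => B.z n (E.param n (ω.hist n)) (ω.hist n) :=
    (hE n).comp (Play.measurable_hist n)
  have he : Measurable fun p : Fin K × (Fin K → ℝ) => p.2 p.1 :=
    measurable_from_prod_countable_right fun k => measurable_pi_apply k
  have ha : Measurable fun ω : Play K => (ω n).1 := (measurable_pi_apply n).fst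
  have : {ω | B.IsFailure E ω n} = ⋃ j, {ω : Play K |
      B.z n (E.param n (ω.hist n)) (ω.hist n) (ω n).1 <
        B.z n (E.param n (ω.hist n)) (ω.hist n) j} := by
    ext ω; simp [IsFailure]
  rw [this]
  exact MeasurableSet.iUnion fun j =>
    measurableSet_lt (he.comp (ha.prodMk hv)) ((measurable_pi_apply j).comp hv)

theorem measurable_failures (E : B.Instance)
    (hE : ∀ n, Measurable fun h => B.z n (E.param n h) h) (t : ℕ) :
    Measurable fun ω => B.failures E ω t := by
  classical
  simp only [failures, Finset.card_filter]
  exact Finset.measurable_sum _ fun n _ =>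
    Measurable.ite (B.measurableSet_isFailure E hE n) measurable_const measurable_const

theorem integrable_failures (E : B.Instance) (π : Policy K)
    (hE : ∀ n, Measurable fun h => B.z n (E.param n h) h) (t : ℕ) :
    Integrable (fun ω => (B.failures E ω t : ℝ)) (B.law E π) := by
  refine Integrable.of_bound (C := t)
    (measurable_from_top.comp (B.measurable_failures E hE t)).aestronglyMeasurable
    (ae_of_all _ fun ω => ?_)
  simpa using B.failures_le E ω t

/-- The summand of the log-likelihood ratio for a reward of arm `k` while arm `j` is optimal. -/
noncomputable def logRatio (θ : Fin K → Θ) (θ' : Fin K → Fin K → Θ) (k j : Fin K) : ℝ → ℝ :=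
  if k = j then 0 else llr (B.f (θ k)) (B.f (θ' k j))

theorem measurable_logRatio (θ : Fin K → Θ) (θ' : Fin K → Fin K → Θ) (k j : Fin K) :
    Measurable (B.logRatio θ θ' k j) := by
  unfold logRatio
  split_ifs
  · exact measurable_const
  · exact measurable_llr _ _

variable [NeZero K]

/-- The change of measure takes test functions of `Hist K t`; through `Hist.extend`, events about
the failures of a play become such functions. -/
theorem failures_extend_hist (E : B.Instance) (ω : Play K) (t : ℕ) :
    B.failures E (ω.hist t).extend t = B.failures E ω t := by
  classical
  unfold failures
  congr 1
  refine Finset.filter_congr fun n hn => ?_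
  have hn := Finset.mem_range.1 hn
  simp only [IsFailure, Hist.hist_extend_hist ω hn.le, Hist.extend_hist_apply ω hn]

variable {B} in
theorem measurable_z_modified (θ : Fin K → Θ) (θ' : Fin K → Fin K → Θ) (n : ℕ) :
    Measurable fun h => B.z n ((B.modified θ θ').param n h) h := by
  have : Measurable fun p : Fin K × Hist K n => B.z n (fun i => θ' i p.1) p.2 :=
    measurable_from_prod_countable_right fun j => B.measurable_z n fun i => θ' i j
  exact this.comp ((B.measurable_opt θ n).prodMk measurable_id)

theorem isFailure_stationary_iff {θ : Fin K → Θ} {ω : Play K} {n : ℕ}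
    (hu : ∃! k, ∀ j, B.z n θ (ω.hist n) j ≤ B.z n θ (ω.hist n) k) :
    B.IsFailure (B.stationary θ) ω n ↔ (ω n).1 ≠ B.opt θ n (ω.hist n) := by
  have hopt : ∀ j, B.z n θ (ω.hist n) j ≤ B.z n θ (ω.hist n) (B.opt θ n (ω.hist n)) :=
    ((argmax_eq_iff _ _).1 rfl).1
  constructor
  · rintro ⟨j, hj⟩ h
    rw [h] at hj
    exact absurd (hopt j) (not_le.2 hj)
  · intro h
    by_contra hf
    simp only [IsFailure, not_exists, not_lt] at hf
    exact h (hu.unique hf hopt)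

/-- Every round of a play is a failure in the original or in the modified instance. -/
theorem ae_le_failures_add (hK : 2 ≤ K) {π : Policy K} {θ : Fin K → Θ} {θ' : Fin K → Fin K → Θ}
    (ha : B.UniqueOptimum π θ) (h : B.Admissible π θ θ') :
    ∀ᵐ ω ∂B.law (B.stationary θ) π, ∀ t,
      t ≤ B.failures (B.stationary θ) ω t + B.failures (B.modified θ θ') ω t := by
  classical
  have : Nontrivial (Fin K) := Fin.nontrivial_iff_two_le.2 hK
  filter_upwards [ha, h.better] with ω hu hb t
  refine le_trans ?_ (Finset.card_union_le _ _)
  rw [← Finset.filter_or, Finset.filter_true_of_mem, Finset.card_range]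
  intro n _
  rw [B.isFailure_stationary_iff (hu n)]
  refine or_iff_not_imp_left.2 fun hn => ?_
  rw [not_not] at hn
  obtain ⟨k, hk⟩ := exists_ne (B.opt θ n (ω.hist n))
  refine ⟨k, ?_⟩
  rw [hn]
  exact (hb n k hk).2

/-- The log-likelihood ratio of the first `t` rounds. -/
noncomputable def logLik (θ : Fin K → Θ) (θ' : Fin K → Fin K → Θ) (ω : Play K) (t : ℕ) : ℝ :=
  ∑ n ∈ Finset.range t, B.logRatio θ θ' (ω n).1 (B.opt θ n (ω.hist n)) (ω n).2

theorem measurable_logRatio_opt (θ : Fin K → Θ) (θ' : Fin K → Fin K → Θ) (n : ℕ) :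
    Measurable fun p : Hist K n × (Fin K × ℝ) =>
      B.logRatio θ θ' p.2.1 (B.opt θ n p.1) p.2.2 := by
  have : Measurable fun q : (Fin K × Fin K) × ℝ => B.logRatio θ θ' q.1.1 q.1.2 q.2 :=
    measurable_from_prod_countable_right fun q => B.measurable_logRatio θ θ' q.1 q.2
  exact this.comp ((measurable_snd.fst.prodMk
    ((B.measurable_opt θ n).comp measurable_fst)).prodMk measurable_snd.snd)

theorem measurable_logLik (θ : Fin K → Θ) (θ' : Fin K → Fin K → Θ) (t : ℕ) :
    Measurable fun ω => B.logLik θ θ' ω t :=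
  Finset.measurable_sum _ fun n _ => (B.measurable_logRatio_opt θ θ' n).comp
    ((Play.measurable_hist n).prodMk (measurable_pi_apply n))

/-- Given the history, the policy picks its arm with the same law in both problems, so only the
rewards enter the likelihood ratio. -/
theorem lintegral_mul_exp_neg_logLik_le (π : Policy K) {θ : Fin K → Θ} {θ' : Fin K → Fin K → Θ}
    (hd : ∀ j, θ' j j = θ j) (hac : ∀ k j, B.f (θ k) ≪ B.f (θ' k j)) (t : ℕ)
    {G : Hist K t → ℝ≥0∞} (hG : Measurable G) :
    ∫⁻ ω, G (ω.hist t) * ENNReal.ofReal (Real.exp (-B.logLik θ θ' ω t))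
        ∂B.law (B.stationary θ) π ≤
      ∫⁻ ω, G (ω.hist t) ∂B.law (B.modified θ θ') π := by
  have hprod : ∀ ω : Play K, ENNReal.ofReal (Real.exp (-B.logLik θ θ' ω t)) =
      ∏ n ∈ Finset.range t, ENNReal.ofReal
        (Real.exp (-B.logRatio θ θ' (ω n).1 (B.opt θ n (ω.hist n)) (ω n).2)) := fun ω => by
    rw [← ENNReal.ofReal_prod_of_nonneg fun _ _ => (Real.exp_pos _).le, ← Real.exp_sum,
      Finset.sum_neg_distrib, logLik]
  simp_rw [hprod]
  refine B.lintegral_law_mul_prod_le _ _ π (fun n h y => ENNReal.ofReal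
    (Real.exp (-B.logRatio θ θ' y.1 (B.opt θ n h) y.2))) (fun n => ?_) (fun n h a G hG => ?_) t G hG
  · exact ((B.measurable_logRatio_opt θ θ' n).neg.exp).ennreal_ofReal
  · have := B.isProbabilityMeasure_f (θ a)
    have := B.isProbabilityMeasure_f (θ' a (B.opt θ n h))
    change ∫⁻ x, _ ∂B.f (θ a) ≤ ∫⁻ x, _ ∂B.f (θ' a (B.opt θ n h))
    -- On the diagonal both reward laws agree, in accordance with the value 0 of `logRatio`.
    by_cases haj : a = B.opt θ n h
    · simp only [logRatio, haj, if_true, hd]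
      simp
    · simp only [logRatio, haj, if_false]
      exact lintegral_mul_exp_neg_llr_le _ _ (hac _ _) hG

/-- If the policy has few failures in the modified instance, then it is unlikely that it has few
failures in the original one while the likelihood ratio is small. -/
theorem eventually_measure_le (π : Policy K) {θ : Fin K → Θ} {θ' : Fin K → Fin K → Θ}
    (hd : ∀ j, θ' j j = θ j) (hac : ∀ k j, B.f (θ k) ≪ B.f (θ' k j)) {δ : ℝ}
    (hcon : B.ConsistentOn δ π (B.modified θ θ')) (a C : ℝ) :
    ∀ᶠ t : ℕ in atTop, B.law (B.stationary θ) π {ω |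
        ((B.failures (B.stationary θ) ω t : ℝ) ≤ C * Real.log t ∧
          t ≤ B.failures (B.stationary θ) ω t + B.failures (B.modified θ θ') ω t) ∧
        B.logLik θ θ' ω t ≤ a * Real.log t} ≤
      ENNReal.ofReal (2 * (t : ℝ) ^ (a + δ - 1)) := by
  have hlog : ∀ᶠ t : ℕ in atTop, C * Real.log t ≤ t / 2 := by
    have h1 := (Real.isLittleO_log_id_atTop.comp_tendsto tendsto_natCast_atTop_atTop).const_mul_left C
    filter_upwards [h1.bound (c := 1 / 2) (by norm_num)] with t ht
    simp only [Function.comp, id, Real.norm_eq_abs, Nat.abs_cast] at ht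
    linarith [le_abs_self (C * Real.log t)]
  filter_upwards [hlog, hcon.bound (c := 1) one_pos, eventually_gt_atTop 0] with t hlt hct ht0
  have ht : (0 : ℝ) < t := by exact_mod_cast ht0
  set N := fun ω => B.failures (B.stationary θ) ω t
  set N' := fun ω => B.failures (B.modified θ θ') ω t
  have hNm : Measurable N := B.measurable_failures _ (fun n => B.measurable_z n θ) t
  have hNm' : Measurable N' := B.measurable_failures _ (measurable_z_modified θ θ') t
  -- The inequality `t ≤ N + N'` is known almost surely only under the original law, so it is made
  -- part of the event before the measure is changed.
  let A : Set (Play K) := {ω | (N ω : ℝ) ≤ C * Real.log t ∧ t ≤ N ω + N' ω}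
  have hA : MeasurableSet A :=
    MeasurableSet.inter (s₁ := {ω | (N ω : ℝ) ≤ C * Real.log t}) (s₂ := {ω | t ≤ N ω + N' ω})
      (measurableSet_le (measurable_from_top.comp hNm) measurable_const)
      (measurableSet_le measurable_const (hNm.add hNm'))
  let G : Hist K t → ℝ≥0∞ := fun h => A.indicator 1 h.extend
  have hG : Measurable G := (measurable_one.indicator hA).comp Hist.measurable_extend
  have hGA : ∀ ω : Play K, G (ω.hist t) = A.indicator 1 ω := fun ω => by
    have : (ω.hist t).extend ∈ A ↔ ω ∈ A := by
      simp only [A, N, N', Set.mem_ofPred_eq, B.failures_extend_hist]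
    by_cases hω : ω ∈ A
    · simp [G, hω, this.2 hω]
    · simp [G, hω, mt this.1 hω]
  have hcm := B.lintegral_mul_exp_neg_logLik_le π hd hac t hG
  simp_rw [hGA] at hcm
  rw [lintegral_indicator_one hA] at hcm
  have hfm : Measurable fun ω : Play K =>
      A.indicator (1 : Play K → ℝ≥0∞) ω * ENNReal.ofReal (Real.exp (-B.logLik θ θ' ω t)) :=
    (measurable_one.indicator hA).mul ((B.measurable_logLik θ θ' t).neg.exp).ennreal_ofReal
  -- Markov's inequality for the weight: on the event, `exp (-L_t) ≥ t^(-a)`.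
  have h1 : ENNReal.ofReal ((t : ℝ) ^ (-a)) * B.law (B.stationary θ) π
      {ω | ω ∈ A ∧ B.logLik θ θ' ω t ≤ a * Real.log t} ≤ B.law (B.modified θ θ') π A := by
    refine le_trans (le_trans ?_ (mul_meas_ge_le_lintegral hfm (ENNReal.ofReal ((t : ℝ) ^ (-a))))) hcm
    refine mul_le_mul_right (measure_mono ?_) _
    rintro ω ⟨hω, hl⟩
    simp only [Set.mem_ofPred_eq, Set.indicator_of_mem hω, Pi.one_apply, one_mul]
    refine ENNReal.ofReal_le_ofReal ?_
    rw [Real.rpow_def_of_pos ht]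
    exact Real.exp_le_exp.2 (by linarith)
  -- Markov's inequality for `N'`, which is at least `t/2` on `A` and has mean at most `t^δ`.
  have h2 : (B.law (B.modified θ θ') π).real A ≤ 2 * (t : ℝ) ^ (δ - 1) := by
    have hmk := mul_meas_ge_le_integral_of_nonneg (μ := B.law (B.modified θ θ') π)
      (f := fun ω => (N' ω : ℝ)) (ae_of_all _ fun _ => Nat.cast_nonneg _)
      (B.integrable_failures _ π (measurable_z_modified θ θ') t) (t / 2)
    have hsub : (B.law (B.modified θ θ') π).real A ≤
        (B.law (B.modified θ θ') π).real {ω | (t : ℝ) / 2 ≤ N' ω} := by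
      refine measureReal_mono ?_
      rintro ω ⟨hω, hl⟩
      have : (t : ℝ) ≤ N ω + N' ω := by exact_mod_cast hl
      simp only [Set.mem_ofPred_eq]
      linarith
    rw [one_mul, Real.norm_eq_abs, Real.norm_eq_abs, abs_of_nonneg (by positivity : 0 ≤ (t : ℝ) ^ δ)]
      at hct
    have h3 := le_trans (le_abs_self _) hct
    have h4 : (t : ℝ) / 2 * (B.law (B.modified θ θ') π).real A ≤ (t : ℝ) ^ δ :=
      le_trans (by gcongr) (hmk.trans h3)
    rw [Real.rpow_sub_one ht.ne', mul_div_assoc', le_div_iff₀ ht]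
    linarith
  have h3 : ENNReal.ofReal ((t : ℝ) ^ a) * ENNReal.ofReal ((t : ℝ) ^ (-a)) = 1 := by
    rw [← ENNReal.ofReal_mul (by positivity), ← Real.rpow_add ht]
    simp
  calc _ = ENNReal.ofReal ((t : ℝ) ^ a) * (ENNReal.ofReal ((t : ℝ) ^ (-a)) *
        B.law (B.stationary θ) π {ω | ω ∈ A ∧ B.logLik θ θ' ω t ≤ a * Real.log t}) := by
        rw [← mul_assoc, h3, one_mul]; rfl
    _ ≤ ENNReal.ofReal ((t : ℝ) ^ a) * ENNReal.ofReal (2 * (t : ℝ) ^ (δ - 1)) := by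
        gcongr
        refine h1.trans ?_
        rw [← ofReal_measureReal]
        exact ENNReal.ofReal_le_ofReal h2
    _ = _ := by
        rw [← ENNReal.ofReal_mul (by positivity), mul_left_comm, ← Real.rpow_add ht]
        ring_nf

/-- Borel–Cantelli along `t = 2^i`, where `2 t^(a+δ-1)` becomes a geometric series of ratio
`2^(a+δ-1) < 1`. Over all `t` the bounds need not be summable. -/
theorem ae_eventually_lt_logLik (hK : 2 ≤ K) {π : Policy K} {θ : Fin K → Θ}
    {θ' : Fin K → Fin K → Θ} (ha : B.UniqueOptimum π θ) (h : B.Admissible π θ θ') {δ : ℝ}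
    (hcon : B.ConsistentOn δ π (B.modified θ θ')) {a : ℝ} (haδ : a < 1 - δ) (C : ℝ) :
    ∀ᵐ ω ∂B.law (B.stationary θ) π, ∀ᶠ i : ℕ in atTop,
      (B.failures (B.stationary θ) ω (2 ^ i) : ℝ) ≤ C * Real.log ((2 ^ i : ℕ) : ℝ) →
        a * Real.log ((2 ^ i : ℕ) : ℝ) < B.logLik θ θ' ω (2 ^ i) := by
  have hev := (tendsto_pow_atTop_atTop_of_one_lt (one_lt_two (α := ℕ))).eventually
    (B.eventually_measure_le π h.diag h.ac hcon a C)
  obtain ⟨i₀, hi₀⟩ := eventually_atTop.1 hev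
  let s : ℕ → Set (Play K) := fun i => {ω |
    ((B.failures (B.stationary θ) ω (2 ^ i) : ℝ) ≤ C * Real.log ((2 ^ i : ℕ) : ℝ) ∧
      2 ^ i ≤ B.failures (B.stationary θ) ω (2 ^ i) + B.failures (B.modified θ θ') ω (2 ^ i)) ∧
    B.logLik θ θ' ω (2 ^ i) ≤ a * Real.log ((2 ^ i : ℕ) : ℝ)}
  have hr : (2 : ℝ) ^ (a + δ - 1) < 1 :=
    Real.rpow_lt_one_of_one_lt_of_neg one_lt_two (by linarith)
  have hsum : Summable fun i : ℕ => 2 * ((2 : ℝ) ^ (a + δ - 1)) ^ i :=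
    (summable_geometric_of_lt_one (by positivity) hr).mul_left 2
  have hle : ∀ i, B.law (B.stationary θ) π (s (i + i₀)) ≤
      ENNReal.ofReal (2 * ((2 : ℝ) ^ (a + δ - 1)) ^ (i + i₀)) := fun i => by
    refine (hi₀ (i + i₀) (Nat.le_add_left _ _)).trans_eq ?_
    congr 2
    push_cast
    rw [← Real.rpow_natCast, ← Real.rpow_natCast, ← Real.rpow_mul two_pos.le,
      ← Real.rpow_mul two_pos.le, mul_comm]
  have hfin : ∑' i, B.law (B.stationary θ) π (s (i + i₀)) ≠ ∞ :=
    ne_top_of_le_ne_top (((summable_nat_add_iff i₀).2 hsum).tsum_ofReal_ne_top)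
      (ENNReal.tsum_le_tsum hle)
  filter_upwards [ae_eventually_notMem hfin, B.ae_le_failures_add hK ha h] with ω hω hgood
  obtain ⟨i₁, hi₁⟩ := eventually_atTop.1 hω
  filter_upwards [eventually_ge_atTop (i₁ + i₀)] with i hi hN
  have := hi₁ (i - i₀) (by omega)
  rw [Nat.sub_add_cancel (by omega)] at this
  by_contra hl
  exact this ⟨⟨hN, hgood _⟩, not_lt.1 hl⟩

end BanditModel

/-! ### Comparison of the likelihood ratio with the divergences. -/

namespace BanditModel

variable {K : ℕ} {Θ : Type*} (B : BanditModel K Θ)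

/-- The Kullback-Leibler divergences of the modified parameters from the original ones. -/
noncomputable def klMatrix (θ : Fin K → Θ) (θ' : Fin K → Fin K → Θ) (k j : Fin K) : ℝ :=
  (InformationTheory.klDiv (B.f (θ k)) (B.f (θ' k j))).toReal

theorem klMatrix_self {θ : Fin K → Θ} {θ' : Fin K → Fin K → Θ} {j : Fin K} (h : θ' j j = θ j) :
    B.klMatrix θ θ' j j = 0 := by
  have := B.isProbabilityMeasure_f (θ j)
  simp [klMatrix, h]

theorem klMatrix_nonneg (θ : Fin K → Θ) (θ' : Fin K → Fin K → Θ) (k j : Fin K) :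
    0 ≤ B.klMatrix θ θ' k j := ENNReal.toReal_nonneg

variable [NeZero K]

theorem sum_opt_eq_sum_pulls (θ : Fin K → Θ) (ω : Play K) (t : ℕ) (F : Fin K → Fin K → ℝ) :
    ∑ n ∈ Finset.range t, F (ω n).1 (B.opt θ n (ω.hist n)) =
      ∑ k, ∑ j, (B.pulls θ ω t k j : ℝ) * F k j := by
  have h : ∀ k j, (B.pulls θ ω t k j : ℝ) * F k j = ∑ n ∈ Finset.range t,
      if (ω n).1 = k ∧ B.opt θ n (ω.hist n) = j then F k j else 0 := fun k j => by
    rw [← Finset.sum_filter, Finset.sum_const, nsmul_eq_mul, pulls]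
  simp_rw [h, Finset.sum_comm (t := Finset.range t)]
  simp [ite_and]

/-- The expected log-likelihood ratio of the first `t` rounds, if a reward of arm `k` contributes
`D k j` while arm `j` is optimal. -/
noncomputable def cost (θ : Fin K → Θ) (D : Fin K → Fin K → ℝ) (ω : Play K) (t : ℕ) : ℝ :=
  ∑ k, ∑ j, (B.pulls θ ω t k j : ℝ) * D k j

theorem ae_failures_eq {π : Policy K} {θ : Fin K → Θ} (ha : B.UniqueOptimum π θ) :
    ∀ᵐ ω ∂B.law (B.stationary θ) π, ∀ t, (B.failures (B.stationary θ) ω t : ℝ) =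
      B.cost θ (fun k j => if k = j then 0 else 1) ω t := by
  classical
  filter_upwards [ha] with ω hu t
  rw [cost, ← sum_opt_eq_sum_pulls, failures, Finset.card_filter]
  push_cast
  refine Finset.sum_congr rfl fun n _ => ?_
  simp only [B.isFailure_stationary_iff (hu n), ne_eq, ite_not]

/-- Matrices that agree on the diagonal differ in cost only through pulls of nonoptimal arms. Hence
an entrywise error `u` costs `u` per failure and not per round. -/
theorem cost_le_add {θ : Fin K → Θ} {ω : Play K} {D D' : Fin K → Fin K → ℝ} {u : ℝ}
    (hd : ∀ j, D j j = D' j j) (h : ∀ k j, D k j ≤ D' k j + u) (t : ℕ) :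
    B.cost θ D ω t ≤
      B.cost θ D' ω t + u * B.cost θ (fun k j => if k = j then 0 else 1) ω t := by
  simp only [cost, Finset.mul_sum, ← Finset.sum_add_distrib]
  refine Finset.sum_le_sum fun k _ => Finset.sum_le_sum fun j _ => ?_
  by_cases hkj : k = j
  · simp [hkj, hd]
  · simp only [hkj, if_false]
    nlinarith [h k j, (B.pulls θ ω t k j).cast_nonneg (α := ℝ)]

theorem sum_pulls_mul_klDiv {θ : Fin K → Θ} {θ' : Fin K → Fin K → Θ}
    (h : ∀ k j, InformationTheory.klDiv (B.f (θ k)) (B.f (θ' k j)) ≠ ∞) (ω : Play K) (t : ℕ) :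
    ∑ k, ∑ j, (B.pulls θ ω t k j : ℝ≥0∞) *
      InformationTheory.klDiv (B.f (θ k)) (B.f (θ' k j)) =
        ENNReal.ofReal (B.cost θ (B.klMatrix θ θ') ω t) := by
  have h0 : ∀ k j, 0 ≤ (B.pulls θ ω t k j : ℝ) * B.klMatrix θ θ' k j := fun k j =>
    mul_nonneg (Nat.cast_nonneg _) (B.klMatrix_nonneg θ θ' k j)
  rw [cost, ENNReal.ofReal_sum_of_nonneg fun k _ => Finset.sum_nonneg fun j _ => h0 k j]
  refine Finset.sum_congr rfl fun k _ => ?_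
  rw [ENNReal.ofReal_sum_of_nonneg fun j _ => h0 k j]
  refine Finset.sum_congr rfl fun j _ => ?_
  rw [ENNReal.ofReal_mul (Nat.cast_nonneg _), ENNReal.ofReal_natCast, klMatrix,
    ENNReal.ofReal_toReal (h k j)]

theorem logLik_eq_sum_selSum (θ : Fin K → Θ) (θ' : Fin K → Fin K → Θ) (ω : Play K) (t : ℕ) :
    B.logLik θ θ' ω t = ∑ k, ∑ j,
      selSum (fun n h a => a = k ∧ B.opt θ n h = j) (B.logRatio θ θ' k j) ω t := by
  classical
  simp_rw [logLik, selSum, Finset.sum_filter, Finset.sum_comm (t := Finset.range t)]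
  simp [ite_and]

/-- The log-likelihood ratio is not much larger than its expectation. -/
theorem ae_exists_logLik_le {π : Policy K} {θ : Fin K → Θ} {θ' : Fin K → Fin K → Θ}
    (ha : B.UniqueOptimum π θ) (h : B.Admissible π θ θ') {ε : ℝ} (hε : 0 < ε) :
    ∀ᵐ ω ∂B.law (B.stationary θ) π, ∃ C : ℝ, ∀ t, B.logLik θ θ' ω t ≤
      B.cost θ (B.klMatrix θ θ') ω t + ε * B.failures (B.stationary θ) ω t + C := by
  classical
  have hpair : ∀ k j, ∀ᵐ ω ∂B.law (B.stationary θ) π, ∃ C : ℝ, ∀ t,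
      selSum (fun n h a => a = k ∧ B.opt θ n h = j) (B.logRatio θ θ' k j) ω t ≤
        B.pulls θ ω t k j * B.klMatrix θ θ' k j +
          ε * (B.pulls θ ω t k j * if k = j then 0 else 1) + C := by
    intro k j
    by_cases hkj : k = j
    -- Diagonal pairs contribute nothing to either side, so no error term is spent on the many pulls
    -- of the optimal arm.
    · refine ae_of_all _ fun ω => ⟨0, fun t => ?_⟩
      subst hkj
      simp [logRatio, selSum, B.klMatrix_self (h.diag k)]
    · have := B.isProbabilityMeasure_f (θ k)
      have := B.isProbabilityMeasure_f (θ' k j)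
      have hH : ∀ n, MeasurableSet {p : Hist K n × Fin K | p.2 = k ∧ B.opt θ n p.1 = j} :=
        fun n => (measurable_snd (measurableSet_singleton k)).inter
          (((B.measurable_opt θ n).comp measurable_fst) (measurableSet_singleton j))
      have hint := (InformationTheory.klDiv_ne_top_iff.1 (h.klDiv_ne_top k j)).2
      filter_upwards [B.ae_exists_selSum_le (B.stationary θ) π
        (H := fun n h a => a = k ∧ B.opt θ n h = j) hH (B.f (θ k))
        (fun n g a hg => by rw [← hg.1]; rfl) (measurable_llr _ (B.f (θ' k j))) hint hε]
        with ω ⟨C, hC⟩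
      refine ⟨C, fun t => ?_⟩
      have hcount : selCount (fun n h a => a = k ∧ B.opt θ n h = j) ω t = B.pulls θ ω t k j := by
        unfold selCount pulls
        congr
      have hkl : ∫ x, llr (B.f (θ k)) (B.f (θ' k j)) x ∂B.f (θ k) = B.klMatrix θ θ' k j :=
        (InformationTheory.toReal_klDiv_of_measure_eq (h.ac k j) (by simp)).symm
      have := hC t
      rw [hcount, hkl] at this
      simp only [logRatio, hkj, if_false]
      linarith
  have hall : ∀ᵐ ω ∂B.law (B.stationary θ) π, ∀ k j, ∃ C : ℝ, ∀ t,
      selSum (fun n h a => a = k ∧ B.opt θ n h = j) (B.logRatio θ θ' k j) ω t ≤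
        B.pulls θ ω t k j * B.klMatrix θ θ' k j +
          ε * (B.pulls θ ω t k j * if k = j then 0 else 1) + C := by
    simp_rw [ae_all_iff]
    exact hpair
  filter_upwards [hall, B.ae_failures_eq ha] with ω hω hN
  choose C hC using hω
  refine ⟨∑ k, ∑ j, C k j, fun t => ?_⟩
  rw [logLik_eq_sum_selSum, hN, cost, cost]
  simp only [Finset.mul_sum, ← Finset.sum_add_distrib]
  exact Finset.sum_le_sum fun k _ => Finset.sum_le_sum fun j _ => hC k j t

/-- The integer `m` has two roles: `m log t` is the allowed number of failures, and `1/(m+1)` is the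
loss both in the exponent and in the strong law. Being countable, the choices of `m` share one null
set. -/
theorem ae_eventually_lt_cost (hK : 2 ≤ K) {π : Policy K} {θ : Fin K → Θ}
    {θ' : Fin K → Fin K → Θ} (ha : B.UniqueOptimum π θ) (h : B.Admissible π θ θ') {δ : ℝ}
    (hcon : B.ConsistentOn δ π (B.modified θ θ')) :
    ∀ᵐ ω ∂B.law (B.stationary θ) π, ∀ m : ℕ, ∃ C : ℝ, ∀ᶠ i : ℕ in atTop,
      (B.failures (B.stationary θ) ω (2 ^ i) : ℝ) ≤ m * Real.log ((2 ^ i : ℕ) : ℝ) →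
        (1 - δ - 1 / (m + 1)) * Real.log ((2 ^ i : ℕ) : ℝ) <
          B.cost θ (B.klMatrix θ θ') ω (2 ^ i) +
            1 / (m + 1) * B.failures (B.stationary θ) ω (2 ^ i) + C := by
  rw [ae_all_iff]
  intro m
  have hm : (0 : ℝ) < 1 / (m + 1) := Nat.one_div_pos_of_nat
  filter_upwards [B.ae_exists_logLik_le ha h hm,
    B.ae_eventually_lt_logLik hK ha h hcon (a := 1 - δ - 1 / (m + 1)) (by linarith) m]
    with ω ⟨C, hC⟩ hω
  exact ⟨C, hω.mono fun i hi hN => (hi hN).trans_le (hC _)⟩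

/-- The exceptional set can be chosen independently of the modified parameters. -/
theorem ae_forall_admissible_eventually_lt_cost (hK : 2 ≤ K) {π : Policy K} {θ : Fin K → Θ}
    (ha : B.UniqueOptimum π θ) {δ : ℝ}
    (hcon : ∀ θ', B.Admissible π θ θ' → B.ConsistentOn δ π (B.modified θ θ')) :
    ∀ᵐ ω ∂B.law (B.stationary θ) π, ∀ θ', B.Admissible π θ θ' → ∀ m : ℕ, ∃ C : ℝ,
      ∀ᶠ i : ℕ in atTop,
        (B.failures (B.stationary θ) ω (2 ^ i) : ℝ) ≤ m * Real.log ((2 ^ i : ℕ) : ℝ) →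
          (1 - δ - 1 / (m + 1)) * Real.log ((2 ^ i : ℕ) : ℝ) <
            B.cost θ (B.klMatrix θ θ') ω (2 ^ i) +
              2 / (m + 1) * B.failures (B.stationary θ) ω (2 ^ i) + C := by
  obtain ⟨T, hTV, hTc, hTd⟩ := (TopologicalSpace.IsSeparable.of_separableSpace
    (B.klMatrix θ '' {θ' | B.Admissible π θ θ'})).exists_countable_dense_subset
  have hT : ∀ᵐ ω ∂B.law (B.stationary θ) π, ∀ D ∈ T, ∀ m : ℕ, ∃ C : ℝ, ∀ᶠ i : ℕ in atTop,
      (B.failures (B.stationary θ) ω (2 ^ i) : ℝ) ≤ m * Real.log ((2 ^ i : ℕ) : ℝ) →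
        (1 - δ - 1 / (m + 1)) * Real.log ((2 ^ i : ℕ) : ℝ) <
          B.cost θ D ω (2 ^ i) +
            1 / (m + 1) * B.failures (B.stationary θ) ω (2 ^ i) + C := by
    rw [ae_ball_iff hTc]
    intro D hD
    obtain ⟨θ', h, rfl⟩ := hTV hD
    exact B.ae_eventually_lt_cost hK ha h (hcon θ' h)
  filter_upwards [hT, B.ae_failures_eq ha] with ω hω hN θ' h m
  have hm : (0 : ℝ) < 1 / (m + 1) := Nat.one_div_pos_of_nat
  -- Replacing the matrix of `θ'` by one at distance below `1/(m+1)` adds another `1/(m+1)` per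
  -- failure, whence the constant `2/(m+1)`.
  obtain ⟨D, hD, hdist⟩ := Metric.mem_closure_iff.1 (hTd ⟨θ', h, rfl⟩) _ hm
  obtain ⟨θ'', h'', rfl⟩ := hTV hD
  obtain ⟨C, hC⟩ := hω _ hD m
  refine ⟨C, hC.mono fun i hi hNi => (hi hNi).trans_le ?_⟩
  have hle : ∀ k j, B.klMatrix θ θ'' k j ≤ B.klMatrix θ θ' k j + 1 / (m + 1) := fun k j => by
    have h1 := (dist_le_pi_dist _ _ j).trans ((dist_le_pi_dist _ _ k).trans hdist.le)
    rw [Real.dist_eq] at h1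
    linarith [neg_abs_le (B.klMatrix θ θ' k j - B.klMatrix θ θ'' k j)]
  have := B.cost_le_add (ω := ω) (θ := θ) (fun j => by
    rw [B.klMatrix_self (h.diag j), B.klMatrix_self (h''.diag j)]) hle (2 ^ i)
  rw [← hN] at this
  have h2 : (2 : ℝ) / (m + 1) = 1 / (m + 1) + 1 / (m + 1) := by ring
  rw [h2, add_mul]
  linarith

end BanditModel

/-! ### The deterministic end of the argument. -/

/-- Going down to the nearest power of two lowers `log t` by at most `log 2`, which the slack `(c' -
c) log t` absorbs. -/
theorem eventually_mul_log_lt_of_pow_two {N : ℕ → ℕ} (hN : Monotone N) {c c' : ℝ} (hc : 0 ≤ c')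
    (hcc : c < c') (h : ∀ᶠ i : ℕ in atTop, c' * Real.log ((2 ^ i : ℕ) : ℝ) < N (2 ^ i)) :
    ∀ᶠ t : ℕ in atTop, c * Real.log t < N t := by
  have hlog : Tendsto (fun t : ℕ => Nat.log 2 t) atTop atTop :=
    tendsto_atTop.2 fun b => (eventually_ge_atTop (2 ^ b)).mono fun t ht =>
      Nat.le_log_of_pow_le one_lt_two ht
  have hbig : ∀ᶠ t : ℕ in atTop, c' * Real.log 2 ≤ (c' - c) * Real.log t :=
    ((Real.tendsto_log_atTop.comp tendsto_natCast_atTop_atTop).const_mul_atTop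
      (sub_pos.2 hcc)).eventually_ge_atTop _
  filter_upwards [hlog.eventually h, hbig, eventually_gt_atTop 0] with t ht hb h0
  have h1 : N (2 ^ Nat.log 2 t) ≤ N t := hN (Nat.pow_log_le_self 2 h0.ne')
  have h2 : Real.log t ≤ Real.log ((2 ^ Nat.log 2 t : ℕ) : ℝ) + Real.log 2 := by
    rw [← Real.log_mul (by positivity) two_ne_zero]
    refine Real.log_le_log (by exact_mod_cast h0) ?_
    have := (Nat.lt_pow_succ_log_self one_lt_two t).le
    rw [pow_succ] at this
    exact_mod_cast this
  have h3 : (N (2 ^ Nat.log 2 t) : ℝ) ≤ N t := by exact_mod_cast h1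
  nlinarith [mul_le_mul_of_nonneg_left h2 hc]

theorem eventually_mul_log_lt {N : ℕ → ℕ} (hN : Monotone N) {x : ℕ → ℝ} {b ρ c c' : ℝ}
    (hc : 0 ≤ c') (hcc : c < c') (hb : c' * ρ < b) (hx : ∀ᶠ t in atTop, x t ≤ ρ * N t)
    (hρ : 0 ≤ ρ)
    (h : ∀ m : ℕ, ∃ C : ℝ, ∀ᶠ i : ℕ in atTop, (N (2 ^ i) : ℝ) ≤ m * Real.log ((2 ^ i : ℕ) : ℝ) →
      (b - 1 / (m + 1)) * Real.log ((2 ^ i : ℕ) : ℝ) <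
        x (2 ^ i) + 2 / (m + 1) * N (2 ^ i) + C) :
    ∀ᶠ t : ℕ in atTop, c * Real.log t < N t := by
  refine eventually_mul_log_lt_of_pow_two hN hc hcc ?_
  have hlim : Tendsto (fun m : ℕ => b - 1 / ((m : ℝ) + 1) - c' * (ρ + 2 * (1 / ((m : ℝ) + 1))))
      atTop (nhds (b - 0 - c' * (ρ + 2 * 0))) :=
    (tendsto_const_nhds.sub tendsto_one_div_add_atTop_nhds_zero_nat).sub
      ((tendsto_const_nhds.add (tendsto_one_div_add_atTop_nhds_zero_nat.const_mul 2)).const_mul c')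
  have hpos : 0 < b - 0 - c' * (ρ + 2 * 0) := by linarith
  -- Besides making the errors small, `m ≥ c'` is needed: then the contrary assumption `N ≤ c' log
  -- t` triggers the implication in `h`.
  obtain ⟨m, hm, hmc⟩ := ((hlim.eventually_const_lt hpos).and
    (tendsto_natCast_atTop_atTop.eventually_ge_atTop c')).exists
  obtain ⟨C, hC⟩ := h m
  have hpow := tendsto_pow_atTop_atTop_of_one_lt (one_lt_two (α := ℕ))
  have hlogt : Tendsto (fun i : ℕ => Real.log ((2 ^ i : ℕ) : ℝ)) atTop atTop :=
    Real.tendsto_log_atTop.comp (tendsto_natCast_atTop_atTop.comp hpow)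
  filter_upwards [hC, hpow.eventually hx, (hlogt.const_mul_atTop hm).eventually_ge_atTop C,
    hlogt.eventually_ge_atTop 0] with i hi hxi hCi hl
  by_contra hlt
  have hle := not_lt.1 hlt
  have h1 := hi (hle.trans (mul_le_mul_of_nonneg_right hmc hl))
  have hu : (0 : ℝ) < 1 / (m + 1) := Nat.one_div_pos_of_nat
  have h2 : (2 : ℝ) / (m + 1) = 2 * (1 / (m + 1)) := by ring
  rw [h2] at h1
  set u : ℝ := 1 / (m + 1)
  have h3 : (ρ + 2 * u) * N (2 ^ i) ≤ (ρ + 2 * u) * (c' * Real.log ((2 ^ i : ℕ) : ℝ)) :=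
    mul_le_mul_of_nonneg_left hle (by positivity)
  nlinarith

/-! ### Rates and the final bounds. -/

namespace BanditModel

variable {K : ℕ} {Θ : Type*} (B : BanditModel K Θ) [NeZero K]

/-- Only failures have a positive divergence, so the average per failure is at most the sum of all
entries of the matrix. Finiteness makes the threshold for `c` positive, which yields `N(t) = Ω(log
t)`. -/
theorem ae_infRate_ne_top {π : Policy K} {θ : Fin K → Θ} (ha : B.UniqueOptimum π θ)
    (hc : ∃ θ', B.Admissible π θ θ') :
    ∀ᵐ ω ∂B.law (B.stationary θ) π, B.infRate π θ ω ≠ ∞ := by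
  obtain ⟨θ', h⟩ := hc
  filter_upwards [B.ae_failures_eq ha] with ω hN
  let b : ℝ := ∑ k, ∑ j, B.klMatrix θ θ' k j
  have hb : ∀ k j, B.klMatrix θ θ' k j ≤ b := fun k j =>
    (Finset.single_le_sum (f := fun j => B.klMatrix θ θ' k j)
      (fun _ _ => B.klMatrix_nonneg _ _ _ _) (Finset.mem_univ j)).trans
    (Finset.single_le_sum (f := fun k => ∑ j, B.klMatrix θ θ' k j)
      (fun _ _ => Finset.sum_nonneg fun _ _ => B.klMatrix_nonneg _ _ _ _) (Finset.mem_univ k))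
  have hrate : B.rate θ θ' ω ≤ ENNReal.ofReal b := by
    refine limsup_le_of_le (h := Eventually.of_forall fun t => ?_)
    rw [B.sum_pulls_mul_klDiv h.klDiv_ne_top]
    refine ENNReal.div_le_of_le_mul ?_
    have hb0 : 0 ≤ b := Finset.sum_nonneg fun _ _ => Finset.sum_nonneg fun _ _ =>
      B.klMatrix_nonneg _ _ _ _
    rw [← ENNReal.ofReal_natCast, ← ENNReal.ofReal_mul hb0]
    refine ENNReal.ofReal_le_ofReal ?_
    have := B.cost_le_add (θ := θ) (ω := ω) (D := B.klMatrix θ θ') (D' := fun _ _ => 0) (u := b)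
      (fun j => B.klMatrix_self (h.diag j)) (fun k j => by simpa using hb k j) t
    rw [← hN] at this
    simpa [cost] using this
  exact ne_top_of_le_ne_top ENNReal.ofReal_ne_top
    ((iInf₂_le (f := fun θ' (_ : B.Admissible π θ θ') => B.rate θ θ' ω) θ' h).trans hrate)

theorem eventually_cost_le_of_rate_lt {θ : Fin K → Θ} {θ' : Fin K → Fin K → Θ} {ω : Play K}
    (h : ∀ k j, InformationTheory.klDiv (B.f (θ k)) (B.f (θ' k j)) ≠ ∞) {ρ : ℝ≥0}
    (hρ : B.rate θ θ' ω < ρ) :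
    ∀ᶠ t in atTop, B.cost θ (B.klMatrix θ θ') ω t ≤ ρ * B.failures (B.stationary θ) ω t := by
  filter_upwards [eventually_lt_of_limsup_lt hρ] with t ht
  rw [B.sum_pulls_mul_klDiv h] at ht
  have h1 : ENNReal.ofReal (B.cost θ (B.klMatrix θ θ') ω t) ≤
      ρ * (B.failures (B.stationary θ) ω t : ℝ≥0∞) := by
    refine (ENNReal.div_le_iff_le_mul (Or.inr ENNReal.coe_ne_top) (Or.inl (by simp))).1 ht.le
  have h2 : (ρ : ℝ≥0∞) * (B.failures (B.stationary θ) ω t : ℝ≥0∞) =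
      ENNReal.ofReal (ρ * B.failures (B.stationary θ) ω t) := by
    rw [ENNReal.ofReal_mul ρ.coe_nonneg, ENNReal.ofReal_coe_nnreal, ENNReal.ofReal_natCast]
  rw [h2] at h1
  exact (ENNReal.ofReal_le_ofReal_iff (by positivity)).1 h1

theorem ae_lower_bound (hK : 2 ≤ K) {π : Policy K} {θ : Fin K → Θ} (ha : B.UniqueOptimum π θ)
    {δ : ℝ} (hcon : ∀ θ', B.Admissible π θ θ' → B.ConsistentOn δ π (B.modified θ θ')) :
    ∀ᵐ ω ∂B.law (B.stationary θ) π, ∀ c : ℝ≥0,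
      (c : ℝ≥0∞) < ENNReal.ofReal (1 - δ) / B.infRate π θ ω →
        ∀ᶠ t : ℕ in atTop, (c : ℝ) * Real.log t < B.failures (B.stationary θ) ω t := by
  filter_upwards [B.ae_forall_admissible_eventually_lt_cost hK ha hcon] with ω hω c hc
  -- The gap between `c` and `c'` serves the passage from powers of two to all `t`; the later gap
  -- between the rate and `ρ` turns the limsup into an eventual bound.
  obtain ⟨c', hcc', hc'⟩ := ENNReal.lt_iff_exists_nnreal_btwn.1 hc
  have hcc : c < c' := by exact_mod_cast hcc'
  have hc0 : (c' : ℝ≥0∞) ≠ 0 := by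
    exact_mod_cast (lt_of_le_of_lt zero_le hcc).ne'
  have h1 : (c' : ℝ≥0∞) * B.infRate π θ ω < ENNReal.ofReal (1 - δ) := ENNReal.mul_lt_of_lt_div hc'
  have h2 : B.infRate π θ ω < ENNReal.ofReal (1 - δ) / c' := by
    rw [ENNReal.lt_div_iff_mul_lt (Or.inl hc0) (Or.inl ENNReal.coe_ne_top), mul_comm]
    exact h1
  simp only [infRate, iInf_lt_iff] at h2
  obtain ⟨θ', h, hrate⟩ := h2
  obtain ⟨ρ, hρ, hρ'⟩ := ENNReal.lt_iff_exists_nnreal_btwn.1 hrate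
  have h3 : (c' : ℝ) * ρ < 1 - δ := by
    rw [ENNReal.lt_div_iff_mul_lt (Or.inl hc0) (Or.inl ENNReal.coe_ne_top), mul_comm,
      ← ENNReal.coe_mul, ← ENNReal.ofReal_coe_nnreal] at hρ'
    exact_mod_cast (ENNReal.ofReal_lt_ofReal_iff_of_nonneg (by positivity)).1 hρ'
  exact eventually_mul_log_lt (B.failures_mono _ ω) c'.2 (by exact_mod_cast hcc) h3
    (B.eventually_cost_le_of_rate_lt h.klDiv_ne_top hρ) ρ.2 (hω θ' h)

theorem log_isBigO_failures {π : Policy K} {θ : Fin K → Θ} {ω : Play K} {b : ℝ≥0∞} (hb : b ≠ 0)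
    (hr : B.infRate π θ ω ≠ ∞)
    (h : ∀ c : ℝ≥0, (c : ℝ≥0∞) < b / B.infRate π θ ω →
      ∀ᶠ t : ℕ in atTop, (c : ℝ) * Real.log t < B.failures (B.stationary θ) ω t) :
    (fun t : ℕ => Real.log t) =O[atTop] fun t : ℕ => (B.failures (B.stationary θ) ω t : ℝ) := by
  obtain ⟨c, hc0, hc⟩ := ENNReal.lt_iff_exists_nnreal_btwn.1 (ENNReal.div_pos hb hr)
  have hc0 : (0 : ℝ) < c := by exact_mod_cast hc0
  refine IsBigO.of_bound (c : ℝ)⁻¹ ?_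
  filter_upwards [h c hc] with t ht
  rw [Real.norm_of_nonneg (Real.log_natCast_nonneg t), Real.norm_of_nonneg (Nat.cast_nonneg _),
    inv_mul_eq_div, le_div_iff₀' hc0]
  exact ht.le

end BanditModel

theorem proposition2 {K : ℕ} [NeZero K] (hK : 2 ≤ K) {Θ : Type*} (B : BanditModel K Θ)
    (π : Policy K) (θ : Fin K → Θ)
    (ha : B.UniqueOptimum π θ) (hc : ∃ θ', B.Admissible π θ θ') :
    (B.Consistent π → ∀ᵐ ω ∂B.law (B.stationary θ) π,
      ((fun t : ℕ => Real.log t) =O[atTop]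
        fun t : ℕ => (B.failures (B.stationary θ) ω t : ℝ)) ∧
      ∀ c : ℝ≥0, (c : ℝ≥0∞) < 1 / B.infRate π θ ω →
        ∀ᶠ t : ℕ in atTop, (c : ℝ) * Real.log t < B.failures (B.stationary θ) ω t) ∧
    ∀ δ ∈ Set.Ioo (0 : ℝ) 1, B.ConsistentWith δ π → ∀ᵐ ω ∂B.law (B.stationary θ) π,
      ((fun t : ℕ => Real.log t) =O[atTop]
        fun t : ℕ => (B.failures (B.stationary θ) ω t : ℝ)) ∧
      ∀ c : ℝ≥0, (c : ℝ≥0∞) < ENNReal.ofReal (1 - δ) / B.infRate π θ ω →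
        ∀ᶠ t : ℕ in atTop, (c : ℝ) * Real.log t < B.failures (B.stationary θ) ω t := by
  have hδ : ∀ δ ∈ Set.Ioo (0 : ℝ) 1, B.ConsistentWith δ π → ∀ᵐ ω ∂B.law (B.stationary θ) π,
      ∀ c : ℝ≥0, (c : ℝ≥0∞) < ENNReal.ofReal (1 - δ) / B.infRate π θ ω →
        ∀ᶠ t : ℕ in atTop, (c : ℝ) * Real.log t < B.failures (B.stationary θ) ω t :=
    fun δ _ h => B.ae_lower_bound hK ha (h θ ha).2
  refine ⟨fun h => ?_, fun δ hd h => ?_⟩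
  -- The exponents `1/(m+2)` lie strictly below 1 and tend to 0. They are countably many, so one
  -- null set serves all of them, and the thresholds tend to `1 / B.infRate π θ ω`.
  · have hm : ∀ m : ℕ, (1 : ℝ) / (m + 1 + 1) ∈ Set.Ioo (0 : ℝ) 1 := fun m =>
      ⟨by positivity, by rw [div_lt_one (by positivity)]; linarith [m.cast_nonneg (α := ℝ)]⟩
    filter_upwards [ae_all_iff.2 fun m => hδ _ (hm m) (h _ (hm m)), B.ae_infRate_ne_top ha hc]
      with ω hω hr
    have key : ∀ c : ℝ≥0, (c : ℝ≥0∞) < 1 / B.infRate π θ ω →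
        ∀ᶠ t : ℕ in atTop, (c : ℝ) * Real.log t < B.failures (B.stationary θ) ω t := by
      intro c hcr
      have hlim : Tendsto (fun m : ℕ => ENNReal.ofReal (1 - 1 / ((m : ℝ) + 1 + 1))) atTop
          (nhds 1) := by
        have h1 : Tendsto (fun m : ℕ => 1 - 1 / (((m + 1 : ℕ) : ℝ) + 1)) atTop (nhds (1 - 0)) :=
          tendsto_const_nhds.sub
            (tendsto_one_div_add_atTop_nhds_zero_nat.comp (tendsto_add_atTop_nat 1))
        have h2 := ENNReal.tendsto_ofReal h1
        simpa using h2
      have hlim' := ENNReal.Tendsto.div_const (b := B.infRate π θ ω) hlim (Or.inl one_ne_zero)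
      obtain ⟨m, hm⟩ := (hlim'.eventually_const_lt hcr).exists
      exact hω m c hm
    exact ⟨B.log_isBigO_failures one_ne_zero hr key, key⟩
  · filter_upwards [hδ δ hd h, B.ae_infRate_ne_top ha hc] with ω hω hr
    exact ⟨B.log_isBigO_failures (by simpa using hd.2) hr hω, hω⟩
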